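/- Complex spaces are reduced, Hausdorff and paracompact: they are covered by open sets identified with analytic subsets of open sets of some $\mathbb C^n$, with transition maps that are locally restrictions of holomorphic maps. A length function on $M$ is a continuous function $E\ge 0$ on the tangent bundle $TM$ (with fibres the Zariski tangent spaces) such that $E(v)=0$ iff $v=0$, and $E(av)=|a|E(v)$ for $a\in\mathbb C$. It is a hermitian metric if on each tangent space $E(v)^2=H(v,v)$ for a hermitian form $H$. It is complete if every Cauchy sequence for $d_E$ converges for $d_E$, where $d_E(x,y)\in[0,\infty]$ is the infimum of the $E$-lengths of the piecewise $C^1$ paths from $x$ to $y$. **Theorem.** Let $\Omega\subset\mathbb C$ be a domain, let $M$ be a complex space with a complete hermitian metric $E$, and let $\mathrm{Hol}(\Omega,M)$ be the space of holomorphic maps $\Omega\to M$ with the compact-open topology. Let $\mathcal F\subset\mathrm{Hol}(\Omega,M)$. Then $\mathcal F$ is not normal (that is, not relatively compact in $\mathrm{Hol}(\Omega,M)$) if and only if there exist sequences $\{p_j\}\subset\Omega$ with $p_j\to p_0\in\Omega$, $\{f_j\}\subset\mathcal F$, and $\{\rho_j\}\subset\mathbb R$ with $\rho_j>0$ and $\rho_j\to0$,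 such that the maps $$g_j(\xi):=f_j(p_j+\rho_j\xi),\qquad \xi\in D_j:=\{\xi\in\mathbb C: p_j+\rho_j\xi\in\Omega\},$$ satisfy one of the following two assertions: (i) $\{g_j\}$ is compactly divergent on $\mathbb C$: for all compact $K\subset\mathbb C$ and $L\subset M$, for all sufficiently large $j$ one has $K\subset D_j$ and $g_j(K)\cap L=\emptyset$; (ii) $\{g_j\}$ converges uniformly on compact subsets of $\mathbb C$ (that is, in the compact-open topology; every compact set is contained in $D_j$ for all large $j$) to a non-constant $E$-Brody curve $g:\mathbb C\to M$, i.e. a non-constant holomorphic map $g$ with $\sup_{z\in\mathbb C}E(g'(z))<\infty$. -/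

import Mathlib

open Set Filter Topology
open scoped ENNReal ComplexConjugate

noncomputable section

/-- `A` is an analytic subset of the open set `D ⊆ ℂⁿ`: it lies in `D`, and every point of `D`
(not only of `A`) has an open neighbourhood `V ⊆ D` in which `A` is the common zero set of finitely
many holomorphic functions.  In particular `A` is closed in `D`. -/
def IsAnalyticSubset {n : ℕ} (D A : Set (Fin n → ℂ)) : Prop :=
  A ⊆ D ∧ ∀ a ∈ D, ∃ V : Set (Fin n → ℂ), IsOpen V ∧ a ∈ V ∧ V ⊆ D ∧
    ∃ (k : ℕ) (h : (Fin n → ℂ) → (Fin k → ℂ)), DifferentiableOn ℂ h V ∧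
      A ∩ V = {z | z ∈ V ∧ h z = 0}

/-- A chart of a (reduced) complex space: a homeomorphism of an open set `source` of `M` onto an
analytic subset of an open set `ambient` of some `ℂⁿ`.  The values of `toFun` off `source` are
irrelevant. -/
structure AnalyticChart (M : Type*) [TopologicalSpace M] where
  dim : ℕ
  source : Set M
  isOpen_source : IsOpen source
  ambient : Set (Fin dim → ℂ)
  isOpen_ambient : IsOpen ambient
  toFun : M → (Fin dim → ℂ)
  isEmbedding : IsEmbedding (source.domRestrict toFun)
  isAnalyticSubset_image : IsAnalyticSubset ambient (toFun '' source)

/-- A reduced complex space structure on a topological space: an atlas of charts onto analytic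
subsets of open sets of `ℂⁿ` (`n` depending on the chart), whose transition maps are, locally,
restrictions of holomorphic maps between the ambient spaces. -/
class ReducedComplexSpace (M : Type*) [TopologicalSpace M] where
  atlas : Set (AnalyticChart M)
  chartAt : M → AnalyticChart M
  chartAt_mem_atlas : ∀ x, chartAt x ∈ atlas
  mem_chartAt_source : ∀ x, x ∈ (chartAt x).source
  compatible : ∀ φ ∈ atlas, ∀ ψ ∈ atlas, ∀ x ∈ φ.source ∩ ψ.source,
    ∃ h : (Fin φ.dim → ℂ) → (Fin ψ.dim → ℂ), AnalyticAt ℂ h (φ.toFun x) ∧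
      ∀ᶠ y in 𝓝 x, ψ.toFun y = h (φ.toFun y)

/-- The (Zariski) tangent space of `M` at `x`, read in the chart `φ`: the vectors of `ℂⁿ`
annihilated by the differentials of all holomorphic germs at `φ x` that vanish on the image of
`M`. -/
def AnalyticChart.tangentSpace {M : Type*} [TopologicalSpace M] (φ : AnalyticChart M) (x : M) :
    Submodule ℂ (Fin φ.dim → ℂ) where
  carrier := {v | ∀ h : (Fin φ.dim → ℂ) → ℂ, AnalyticAt ℂ h (φ.toFun x) →
    (∀ᶠ y in 𝓝 x, h (φ.toFun y) = 0) → fderiv ℂ h (φ.toFun x) v = 0}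
  add_mem' := by
    intro v w hv hw h ha h0
    rw [map_add, hv h ha h0, hw h ha h0, add_zero]
  zero_mem' := by
    intro h _ _
    exact map_zero _
  smul_mem' := by
    intro c v hv h ha h0
    rw [map_smul, hv h ha h0, smul_zero]

section Metric

variable {M : Type*} [TopologicalSpace M] [ReducedComplexSpace M]

/-- A length function on `M`: a continuous function `E ≥ 0` on the tangent bundle `TM` with
`E v = 0` iff `v = 0` and `E (a v) = |a| E v`.  The tangent bundle is glued from its charts
`{(x, v) | x ∈ φ.source, v ∈ φ.tangentSpace x}` along the differentials of the transition maps, so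
a continuous function on it is a family of continuous functions, one for each chart of the atlas,
compatible with these differentials. -/
structure LengthFunction (M : Type*) [TopologicalSpace M] [ReducedComplexSpace M] where
  toFun : (φ : AnalyticChart M) → M → (Fin φ.dim → ℂ) → ℝ
  compatible : ∀ φ ∈ ReducedComplexSpace.atlas (M := M),
    ∀ ψ ∈ ReducedComplexSpace.atlas (M := M), ∀ x ∈ φ.source ∩ ψ.source,
    ∀ h : (Fin φ.dim → ℂ) → (Fin ψ.dim → ℂ), AnalyticAt ℂ h (φ.toFun x) →
      (∀ᶠ y in 𝓝 x, ψ.toFun y = h (φ.toFun y)) →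
      ∀ v ∈ φ.tangentSpace x, toFun ψ x (fderiv ℂ h (φ.toFun x) v) = toFun φ x v
  continuousOn : ∀ φ ∈ ReducedComplexSpace.atlas (M := M),
    ContinuousOn (fun q : M × (Fin φ.dim → ℂ) => toFun φ q.1 q.2)
      {q | q.1 ∈ φ.source ∧ q.2 ∈ φ.tangentSpace q.1}
  nonneg : ∀ φ ∈ ReducedComplexSpace.atlas (M := M), ∀ x ∈ φ.source,
    ∀ v ∈ φ.tangentSpace x, 0 ≤ toFun φ x v
  eq_zero_iff : ∀ φ ∈ ReducedComplexSpace.atlas (M := M), ∀ x ∈ φ.source,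
    ∀ v ∈ φ.tangentSpace x, toFun φ x v = 0 ↔ v = 0
  map_smul : ∀ φ ∈ ReducedComplexSpace.atlas (M := M), ∀ x ∈ φ.source,
    ∀ v ∈ φ.tangentSpace x, ∀ a : ℂ, toFun φ x (a • v) = ‖a‖ * toFun φ x v

/-- `E` is (the norm of) a hermitian metric: on every tangent space `E v ^ 2 = H(v, v)` for a
hermitian form `H`.  Positivity and continuity of `H` follow from those of `E`. -/
def LengthFunction.IsHermitian (E : LengthFunction M) : Prop :=
  ∀ φ ∈ ReducedComplexSpace.atlas (M := M), ∀ x ∈ φ.source,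
    ∃ H : φ.tangentSpace x →ₗ⋆[ℂ] φ.tangentSpace x →ₗ[ℂ] ℂ,
      (∀ v w, H v w = conj (H w v)) ∧
      ∀ v : φ.tangentSpace x, H v v = ((E.toFun φ x v ^ 2 : ℝ) : ℂ)

/-- A `C¹` arc in `M` from `x` to `y`, parametrized by `[0, 1]`. -/
structure C1Arc (x y : M) where
  toFun : ℝ → M
  map_zero : toFun 0 = x
  map_one : toFun 1 = y
  continuousOn : ContinuousOn toFun (Icc 0 1)
  contDiffWithinAt : ∀ φ ∈ ReducedComplexSpace.atlas (M := M), ∀ t ∈ Icc (0 : ℝ) 1,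
    toFun t ∈ φ.source →
      ContDiffWithinAt ℝ 1 (fun s => φ.toFun (toFun s)) (Icc 0 1) t

/-- The `E`-length `∫₀¹ E(γ'(t)) dt` of a `C¹` arc. -/
def LengthFunction.arcLength (E : LengthFunction M) {x y : M} (γ : C1Arc x y) : ℝ≥0∞ :=
  ∫⁻ t in Icc (0 : ℝ) 1, ENNReal.ofReal
    (E.toFun (ReducedComplexSpace.chartAt (γ.toFun t)) (γ.toFun t)
      (derivWithin (fun s => (ReducedComplexSpace.chartAt (γ.toFun t)).toFun (γ.toFun s))
        (Icc 0 1) t))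

/-- A piecewise `C¹` path in `M`: a finite concatenation of `C¹` arcs. -/
inductive PiecewiseC1Path {M : Type*} [TopologicalSpace M] [ReducedComplexSpace M] :
    M → M → Type _
  | nil (x : M) : PiecewiseC1Path x x
  | cons {x y z : M} (γ : C1Arc x y) (c : PiecewiseC1Path y z) : PiecewiseC1Path x z

/-- The `E`-length of a piecewise `C¹` path. -/
def LengthFunction.length (E : LengthFunction M) :
    {x y : M} → PiecewiseC1Path x y → ℝ≥0∞
  | _, _, .nil _ => 0
  | _, _, .cons γ c => E.arcLength γ + LengthFunction.length E c

/-- The distance `d_E` induced by `E`: the infimum of the lengths of piecewise `C¹` paths (`∞` if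
there is no such path). -/
def LengthFunction.dist (E : LengthFunction M) (x y : M) : ℝ≥0∞ :=
  ⨅ c : PiecewiseC1Path x y, E.length c

/-- `(M, d_E)` is complete: every `d_E`-Cauchy sequence `d_E`-converges. -/
def LengthFunction.IsComplete (E : LengthFunction M) : Prop :=
  ∀ u : ℕ → M, (∀ ε : ℝ≥0∞, 0 < ε → ∃ N, ∀ m ≥ N, ∀ n ≥ N, E.dist (u m) (u n) < ε) →
    ∃ x, Tendsto (fun n => E.dist (u n) x) atTop (𝓝 0)

end Metric

open Classical in
/-- A map `f : Ω → M` read in the chart `φ`, as a function on `ℂ` (with the irrelevant value `0`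
off `Ω`). -/
def AnalyticChart.read {M : Type*} [TopologicalSpace M] (φ : AnalyticChart M) {Ω : Set ℂ}
    (f : Ω → M) (z : ℂ) : Fin φ.dim → ℂ :=
  if hz : z ∈ Ω then φ.toFun (f ⟨z, hz⟩) else 0

/-- `Hol(Ω, M)` for open `Ω ⊆ ℂ`: the continuous maps that are holomorphic in every chart.  As a
subspace of `C(Ω, M)` it carries the compact-open topology. -/
abbrev Hol (Ω : Set ℂ) (M : Type*) [TopologicalSpace M] [ReducedComplexSpace M] : Type _ :=
  {f : C(Ω, M) // ∀ φ ∈ ReducedComplexSpace.atlas (M := M), ∀ z : Ω, f z ∈ φ.source →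
    DifferentiableAt ℂ (φ.read f) z}

section Families

variable {M : Type*} [TopologicalSpace M] [ReducedComplexSpace M]

/-- A family is normal if it is relatively compact in `Hol(Ω, M)`. -/
def IsNormalFamily {Ω : Set ℂ} (F : Set (Hol Ω M)) : Prop :=
  IsCompact (closure F)

/-- A holomorphic curve `g : ℂ → M` is an `E`-Brody curve if `|g'|_E` is bounded on `ℂ`. -/
def IsBrodyCurve (E : LengthFunction M) (g : Hol univ M) : Prop :=
  ∃ C : ℝ, ∀ φ ∈ ReducedComplexSpace.atlas (M := M), ∀ z : (univ : Set ℂ), g.1 z ∈ φ.source →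
    E.toFun φ (g.1 z) (deriv (φ.read g.1) z) ≤ C

/-- The set of all `ξ` for which `f (p + ρ ξ)` makes sense, for `f` defined on `Ω`. -/
def rescaleDomain (Ω : Set ℂ) (p : ℂ) (ρ : ℝ) : Set ℂ :=
  {ξ | p + (ρ : ℂ) * ξ ∈ Ω}

/-- The rescaled map `ξ ↦ f (p + ρ ξ)`. -/
def rescale {Ω : Set ℂ} (f : Hol Ω M) (p : ℂ) (ρ : ℝ) (ξ : rescaleDomain Ω p ρ) : M :=
  f.1 ⟨p + (ρ : ℂ) * (ξ : ℂ), ξ.2⟩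

/-- Compact divergence on `ℂ` of maps `g j : D j → M` on subsets `D j` of `ℂ` that eventually
contain any given compact set. -/
def CompactlyDivergent {D : ℕ → Set ℂ} (g : ∀ j, D j → M) : Prop :=
  ∀ K : Set ℂ, IsCompact K → ∀ L : Set M, IsCompact L →
    ∀ᶠ j in atTop, K ⊆ D j ∧ ∀ ξ : D j, (ξ : ℂ) ∈ K → g j ξ ∉ L

/-- Convergence, uniform on compact subsets of `ℂ`, of maps `g j : D j → M` to the continuous map
`g : ℂ → M`.  This is convergence in the compact-open topology, which is uniform convergence on
compact sets for any metric defining the topology of `M`. -/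
def ConvergesOnCompacts {D : ℕ → Set ℂ} (g : ∀ j, D j → M) (g₀ : Hol univ M) : Prop :=
  ∀ K : Set ℂ, IsCompact K → ∀ U : Set M, IsOpen U →
    (∀ ξ : (univ : Set ℂ), (ξ : ℂ) ∈ K → g₀.1 ξ ∈ U) →
      ∀ᶠ j in atTop, K ⊆ D j ∧ ∀ ξ : D j, (ξ : ℂ) ∈ K → g j ξ ∈ U

end Families

end

/-!
# Normal families of holomorphic maps into a complete hermitian complex space

If a family is normal, its rescalings at points converging inside `Ω` accumulate only at constants,
which excludes both compact divergence and a non-constant limit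
(`IsNormalFamily.not_rescaling`).

Conversely, let `F` not be normal. If the speeds `E(f')`, `f ∈ F`, are locally bounded, then `F` is
equicontinuous for `d_E`, and by the Arzelà–Ascoli argument of `isNormalFamily_of_speed_le` the
values of `F` at some point `z` are not relatively compact. By paracompactness some sequence of
these values leaves every compact set (`exists_seq_eventually_notMem`), and the maps, rescaled at
`z`, diverge with it (`compactlyDivergent_rescale_of_speed_le`). If the speeds are unbounded near
`z`, Zalcman's rescaling (`exists_rescaling`, from Hofer's lemma) gives maps `g_j` on larger and
larger discs with speed at most `2`, and equal to `1` at the origin. When they are not compactly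
divergent, they converge at one point along an ultrafilter on the indices. Completeness
propagates this convergence to all of `ℂ` (`LengthFunction.IsComplete.exists_tendsto`), and the
limit is holomorphic with speed at most `2`, and `1` at the origin: a non-constant Brody curve.

The length distance `d_E` is related to the topology of `M` in one direction only: a point of small
`d_E`-distance to `x` is close to `x` (`LengthFunction.exists_dist_lt_imp_mem`), because near `x`
the length function dominates a multiple of the norm of a chart. This and the Lipschitz bound
`HolOn.dist_le` suffice; that `d_E` is continuous on `M`, a fact about the local structure of
singular analytic sets, is never needed. Limits are taken along ultrafilters, for which relative
compactness yields convergence directly, and a subsequence is extracted only once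
(`ConvergesLocally.exists_subseq`).
-/

open ReducedComplexSpace MeasureTheory Metric

/-! ### Velocities of curves in a complex space -/

section Velocity

variable {M : Type*} [TopologicalSpace M] {𝕜 : Type*} [NontriviallyNormedField 𝕜]
  [NormedAlgebra 𝕜 ℂ] {γ : 𝕜 → M} {s : Set 𝕜} {t : 𝕜}

/-- The velocity of a curve, real or holomorphic, is a tangent vector. -/
theorem AnalyticChart.mem_tangentSpace_of_hasDerivWithinAt (φ : AnalyticChart M)
    {v : Fin φ.dim → ℂ} (hs : UniqueDiffWithinAt 𝕜 s t)
    (hc : ContinuousWithinAt γ s t)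
    (hd : HasDerivWithinAt (fun u => φ.toFun (γ u)) v s t) : v ∈ φ.tangentSpace (γ t) := by
  intro h ha h0
  have h1 : HasDerivWithinAt (fun u => h (φ.toFun (γ u))) (fderiv ℂ h (φ.toFun (γ t)) v) s t :=
    HasFDerivAt.comp_hasDerivWithinAt (l := h) (f := fun u => φ.toFun (γ u)) t
      (ha.differentiableAt.hasFDerivAt.restrictScalars 𝕜) hd
  have h2 : HasDerivWithinAt (fun u => h (φ.toFun (γ u))) 0 s t :=
    (hasDerivWithinAt_const t s (0 : ℂ)).congr_of_eventuallyEq (hc.eventually h0) h0.self_of_nhds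
  exact hs.eq_deriv s h1 h2

variable [ReducedComplexSpace M]

/-- The length of the velocity of a curve does not depend on the chart in which it is read. -/
theorem LengthFunction.toFun_eq_of_hasDerivWithinAt (E : LengthFunction M) {φ ψ : AnalyticChart M}
    (hφ : φ ∈ atlas (M := M)) (hψ : ψ ∈ atlas (M := M)) (htφ : γ t ∈ φ.source)
    (htψ : γ t ∈ ψ.source) {v : Fin φ.dim → ℂ} {w : Fin ψ.dim → ℂ}
    (hs : UniqueDiffWithinAt 𝕜 s t) (hc : ContinuousWithinAt γ s t)
    (hv : HasDerivWithinAt (fun u => φ.toFun (γ u)) v s t)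
    (hw : HasDerivWithinAt (fun u => ψ.toFun (γ u)) w s t) :
    E.toFun φ (γ t) v = E.toFun ψ (γ t) w := by
  obtain ⟨h, ha, h0⟩ := ReducedComplexSpace.compatible φ hφ ψ hψ (γ t) ⟨htφ, htψ⟩
  have h1 : HasDerivWithinAt (fun u => h (φ.toFun (γ u))) (fderiv ℂ h (φ.toFun (γ t)) v) s t :=
    HasFDerivAt.comp_hasDerivWithinAt (l := h) (f := fun u => φ.toFun (γ u)) t
      (ha.differentiableAt.hasFDerivAt.restrictScalars 𝕜) hv
  have h2 := h1.congr_of_eventuallyEq (hc.eventually h0) h0.self_of_nhds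
  rw [hs.eq_deriv s hw h2]
  exact (E.compatible φ hφ ψ hψ (γ t) ⟨htφ, htψ⟩ h ha h0 v
    (φ.mem_tangentSpace_of_hasDerivWithinAt hs hc hv)).symm

end Velocity

/-! ### Local geometry of a complex space with a length function -/

section LocalGeometry

variable {M : Type*} [TopologicalSpace M]

theorem AnalyticChart.continuousOn (φ : AnalyticChart M) : ContinuousOn φ.toFun φ.source :=
  continuousOn_iff_continuous_domRestrict.2 φ.isEmbedding.continuous

theorem AnalyticChart.continuousAt (φ : AnalyticChart M) {x : M} (hx : x ∈ φ.source) :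
    ContinuousAt φ.toFun x :=
  φ.continuousOn.continuousAt (φ.isOpen_source.mem_nhds hx)

/-- Tangent vectors form a closed subset of the tangent bundle: a germ that vanishes on `M` near `x`
vanishes on `M` near the points close to `x`. -/
theorem AnalyticChart.eventually_notMem_tangentSpace (φ : AnalyticChart M) {x : M}
    (hx : x ∈ φ.source) {v : Fin φ.dim → ℂ} (hv : v ∉ φ.tangentSpace x) :
    ∀ᶠ q : M × (Fin φ.dim → ℂ) in 𝓝 (x, v), q.2 ∉ φ.tangentSpace q.1 := by
  have hv' : ¬ ∀ h : (Fin φ.dim → ℂ) → ℂ, AnalyticAt ℂ h (φ.toFun x) →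
    (∀ᶠ y in 𝓝 x, h (φ.toFun y) = 0) → fderiv ℂ h (φ.toFun x) v = 0 := hv
  push Not at hv'
  obtain ⟨h, ha, h0, hne⟩ := hv'
  have hφ := φ.continuousAt hx
  have c1 : ContinuousAt (fun q : M × (Fin φ.dim → ℂ) => fderiv ℂ h (φ.toFun q.1) q.2) (x, v) := by
    have c0 : ContinuousAt (fun q : M × (Fin φ.dim → ℂ) => fderiv ℂ h (φ.toFun q.1)) (x, v) :=
      ContinuousAt.comp (f := fun q : M × (Fin φ.dim → ℂ) => φ.toFun q.1)
        (g := fderiv ℂ h) ha.fderiv.continuousAt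
        (ContinuousAt.comp (f := Prod.fst) (g := φ.toFun) hφ continuousAt_fst)
    exact c0.clm_apply continuousAt_snd
  have e1 := c1.eventually_ne hne
  have e2 : ∀ᶠ y in 𝓝 x, AnalyticAt ℂ h (φ.toFun y) := hφ.eventually ha.eventually_analyticAt
  have e3 := eventually_eventually_nhds.2 h0
  have e4 := (continuousAt_fst (p := (x, v))).eventually (e2.and e3)
  filter_upwards [e1, e4] with q hq1 hq2 hq3
  exact hq1 (hq3 h hq2.1 hq2.2)

/-- Small closed balls of a chart are compact, because analytic subsets are locally closed. -/
theorem AnalyticChart.exists_isCompact_ball (φ : AnalyticChart M) {x : M} (hx : x ∈ φ.source)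
    {U : Set M} (hU : U ∈ 𝓝 x) : ∃ r : ℝ, 0 < r ∧
      IsCompact {y | y ∈ φ.source ∧ ‖φ.toFun y - φ.toFun x‖ ≤ r} ∧
      {y | y ∈ φ.source ∧ ‖φ.toFun y - φ.toFun x‖ ≤ r} ⊆ U := by
  set a := φ.toFun x with ha
  have haA : a ∈ φ.toFun '' φ.source := mem_image_of_mem _ hx
  obtain ⟨hsub, hloc⟩ := φ.isAnalyticSubset_image
  obtain ⟨V, hVo, haV, -, k, h, hd, hz⟩ := hloc a (hsub haA)
  obtain ⟨r₁, hr₁, hb₁⟩ := nhds_basis_closedBall.mem_iff.1 (hVo.mem_nhds haV)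
  have hU' : Subtype.val ⁻¹' U ∈ 𝓝 (⟨x, hx⟩ : φ.source) :=
    continuous_subtype_val.continuousAt.preimage_mem_nhds hU
  rw [φ.isEmbedding.nhds_eq_comap, mem_comap] at hU'
  obtain ⟨W, hW, hWU⟩ := hU'
  obtain ⟨r₂, hr₂, hb₂⟩ := nhds_basis_closedBall.mem_iff.1 hW
  have hrpos : 0 < min r₁ r₂ := lt_min hr₁ hr₂
  refine ⟨min r₁ r₂, hrpos, ?_, ?_⟩
  · have hBV : closedBall a (min r₁ r₂) ⊆ V :=
      (closedBall_subset_closedBall (min_le_left _ _)).trans hb₁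
    have hK : IsCompact (φ.toFun '' φ.source ∩ closedBall a (min r₁ r₂)) := by
      have e : φ.toFun '' φ.source ∩ closedBall a (min r₁ r₂) =
          closedBall a (min r₁ r₂) ∩ h ⁻¹' {0} := by
        ext z
        constructor
        · rintro ⟨h1, h2⟩
          have : z ∈ {z | z ∈ V ∧ h z = 0} := hz ▸ ⟨h1, hBV h2⟩
          exact ⟨h2, this.2⟩
        · rintro ⟨h1, h2⟩
          have : z ∈ φ.toFun '' φ.source ∩ V := hz ▸ ⟨hBV h1, h2⟩
          exact ⟨this.1, h1⟩
      rw [e]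
      exact (isCompact_closedBall a _).of_isClosed_subset
        ((hd.continuousOn.mono hBV).preimage_isClosed_of_isClosed isClosed_closedBall
          isClosed_singleton) inter_subset_left
    have hK' := φ.isEmbedding.isInducing.isCompact_preimage'
      (K := φ.toFun '' φ.source ∩ closedBall a (min r₁ r₂)) hK (by
        rintro _ ⟨⟨y, hy, rfl⟩, -⟩
        exact ⟨⟨y, hy⟩, rfl⟩)
    convert hK'.image continuous_subtype_val using 1
    ext y
    constructor
    · rintro ⟨h1, h2⟩
      exact ⟨⟨y, h1⟩, ⟨mem_image_of_mem _ h1, mem_closedBall_iff_norm.2 h2⟩, rfl⟩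
    · rintro ⟨⟨y, h1⟩, ⟨-, h2⟩, rfl⟩
      exact ⟨h1, mem_closedBall_iff_norm.1 h2⟩
  · rintro y ⟨h1, h2⟩
    have h3 : (⟨y, h1⟩ : φ.source) ∈ φ.source.domRestrict φ.toFun ⁻¹' W :=
      hb₂ (mem_closedBall_iff_norm.2 (h2.trans (min_le_right _ _)))
    exact hWU h3

variable [ReducedComplexSpace M]

/-- A length function dominates, near every point, a multiple of the norm of a chart. -/
theorem LengthFunction.eventually_norm_le (E : LengthFunction M) {φ : AnalyticChart M}
    (hφ : φ ∈ atlas (M := M)) {x : M} (hx : x ∈ φ.source) :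
    ∃ c : ℝ, 0 < c ∧ ∀ᶠ y in 𝓝 x, ∀ v ∈ φ.tangentSpace y, c * ‖v‖ ≤ E.toFun φ y v := by
  -- the candidate lower bound on the unit sphere is a parameter near `0`, so that compactness of
  -- the sphere provides a uniform one
  have key : ∀ᶠ q : M × ℝ in 𝓝 (x, 0), ∀ v ∈ sphere (0 : Fin φ.dim → ℂ) 1,
      v ∈ φ.tangentSpace q.1 → q.2 < E.toFun φ q.1 v := by
    refine (isCompact_sphere (0 : Fin φ.dim → ℂ) 1).eventually_forall_of_forall_eventually
      (P := fun (q : M × ℝ) v => v ∈ φ.tangentSpace q.1 → q.2 < E.toFun φ q.1 v) ?_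
    intro v hv
    have hv0 : v ≠ 0 := by
      rintro rfl
      simp at hv
    have cP : Tendsto (fun z : (M × ℝ) × (Fin φ.dim → ℂ) => (z.1.1, z.2)) (𝓝 ((x, 0), v))
        (𝓝 (x, v)) :=
      ((continuous_fst.comp continuous_fst).prodMk continuous_snd).tendsto _
    by_cases hT : v ∈ φ.tangentSpace x
    · have hpos : 0 < E.toFun φ x v :=
        lt_of_le_of_ne (E.nonneg φ hφ x hx v hT)
          (fun h => hv0 ((E.eq_zero_iff φ hφ x hx v hT).1 h.symm))
      have h1 := (E.continuousOn φ hφ (x, v) ⟨hx, hT⟩).eventually (lt_mem_nhds (half_lt_self hpos))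
      rw [eventually_nhdsWithin_iff] at h1
      have cs : Tendsto (fun z : (M × ℝ) × (Fin φ.dim → ℂ) => z.1.1) (𝓝 ((x, 0), v)) (𝓝 x) :=
        (continuous_fst.comp continuous_fst).tendsto _
      have cr : Tendsto (fun z : (M × ℝ) × (Fin φ.dim → ℂ) => z.1.2) (𝓝 ((x, 0), v)) (𝓝 0) :=
        (continuous_snd.comp continuous_fst).tendsto _
      filter_upwards [cP.eventually h1, cr.eventually (gt_mem_nhds (half_pos hpos)),
        cs.eventually (φ.isOpen_source.mem_nhds hx)] with z hz1 hz2 hz3 hz4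
      exact hz2.trans (hz1 ⟨hz3, hz4⟩)
    · filter_upwards [cP.eventually (φ.eventually_notMem_tangentSpace hx hT)] with z hz1 hz2
      exact absurd hz2 hz1
  rw [nhds_prod_eq] at key
  obtain ⟨pa, ha, pb, hb, hab⟩ := eventually_prod_iff.1 key
  obtain ⟨c, hc0, hc⟩ : ∃ c : ℝ, 0 < c ∧ pb c :=
    ((eventually_mem_nhdsWithin (a := (0 : ℝ)) (s := Ioi 0)).and
      (hb.filter_mono nhdsWithin_le_nhds)).exists
  refine ⟨c, hc0, ?_⟩
  filter_upwards [ha, φ.isOpen_source.mem_nhds hx] with y hy hys v hv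
  rcases eq_or_ne v 0 with rfl | hv0
  · rw [norm_zero, mul_zero]
    exact E.nonneg φ hφ y hys _ hv
  · have hn : 0 < ‖v‖ := norm_pos_iff.2 hv0
    have h1 := hab hy hc (((‖v‖⁻¹ : ℝ) : ℂ) • v) (by simp [norm_smul, hn.ne'])
      ((φ.tangentSpace y).smul_mem _ hv)
    rw [E.map_smul φ hφ y hys v hv] at h1
    have h2 : ‖((‖v‖⁻¹ : ℝ) : ℂ)‖ = ‖v‖⁻¹ := by simp
    rw [h2, inv_mul_eq_div, lt_div_iff₀ hn] at h1
    exact h1.le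

theorem locallyCompactSpace_of_reducedComplexSpace : LocallyCompactSpace M := by
  refine ⟨fun x n hn => ?_⟩
  have hx := mem_chartAt_source x
  obtain ⟨r, hr, hc, hs⟩ := (chartAt x).exists_isCompact_ball hx hn
  refine ⟨_, ?_, hs, hc⟩
  filter_upwards [(chartAt x).isOpen_source.mem_nhds hx,
    ((chartAt x).continuousAt hx).preimage_mem_nhds (closedBall_mem_nhds _ hr)] with y h1 h2
  exact ⟨h1, mem_closedBall_iff_norm.1 h2⟩

/-- A compact ball of a chart on which a length function dominates a multiple of the norm. -/
theorem LengthFunction.exists_good_ball (E : LengthFunction M) {φ : AnalyticChart M}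
    (hφ : φ ∈ atlas (M := M)) {x : M} (hx : x ∈ φ.source) {U : Set M} (hU : U ∈ 𝓝 x) :
    ∃ r c : ℝ, 0 < r ∧ 0 < c ∧
      IsCompact {y | y ∈ φ.source ∧ ‖φ.toFun y - φ.toFun x‖ ≤ r} ∧
      ∀ y ∈ φ.source, ‖φ.toFun y - φ.toFun x‖ ≤ r →
        y ∈ U ∧ ∀ v ∈ φ.tangentSpace y, c * ‖v‖ ≤ E.toFun φ y v := by
  obtain ⟨c, hc, hE⟩ := E.eventually_norm_le hφ hx
  obtain ⟨r, hr, hK, hs⟩ := φ.exists_isCompact_ball hx (inter_mem hU hE)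
  exact ⟨r, c, hr, hc, hK, fun y h1 h2 => hs ⟨h1, h2⟩⟩

end LocalGeometry

/-! ### Short paths stay close to their origin -/

section Paths

variable {M : Type*} [TopologicalSpace M] [ReducedComplexSpace M]

/-- An initial piece of an arc, as long as it stays in the good part of a chart, is at least as long
as `c` times the displacement in the chart. -/
theorem LengthFunction.norm_sub_le_arcLength (E : LengthFunction M) {φ : AnalyticChart M}
    (hφ : φ ∈ atlas (M := M)) {N : Set M} (hN : N ⊆ φ.source) {c : ℝ} (hc : 0 < c)
    (hE : ∀ y ∈ N, ∀ v ∈ φ.tangentSpace y, c * ‖v‖ ≤ E.toFun φ y v)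
    {y z : M} (γ : C1Arc y z) {T : ℝ} (hT : T ∈ Icc (0 : ℝ) 1)
    (hγ : ∀ t ∈ Icc (0 : ℝ) T, γ.toFun t ∈ N) :
    ENNReal.ofReal (c * ‖φ.toFun (γ.toFun T) - φ.toFun y‖) ≤ E.arcLength γ := by
  rcases hT.1.eq_or_lt with rfl | hT0
  · simp [γ.map_zero]
  have hsub : Icc 0 T ⊆ Icc (0 : ℝ) 1 := Icc_subset_Icc_right hT.2
  set u : ℝ → Fin φ.dim → ℂ := fun s => φ.toFun (γ.toFun s) with hu
  have hcd1 : ∀ t ∈ Icc (0 : ℝ) T, ContDiffWithinAt ℝ 1 u (Icc 0 1) t := fun t ht =>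
    γ.contDiffWithinAt φ hφ t (hsub ht) (hN (hγ t ht))
  have h1 := enorm_sub_le_lintegral_derivWithin_Icc_of_contDiffOn_Icc
    (fun t ht => (hcd1 t ht).mono hsub : ContDiffOn ℝ 1 u (Icc 0 T)) hT0.le
  have h0 : u 0 = φ.toFun y := by simp [hu, γ.map_zero]
  rw [← h0, ENNReal.ofReal_mul hc.le, ofReal_norm]
  calc ENNReal.ofReal c * ‖u T - u 0‖ₑ
      ≤ ENNReal.ofReal c * ∫⁻ t in Icc 0 T, ‖derivWithin u (Icc 0 T) t‖ₑ := by gcongr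
    _ = ∫⁻ t in Icc 0 T, ENNReal.ofReal c * ‖derivWithin u (Icc 0 T) t‖ₑ :=
        (lintegral_const_mul' _ _ ENNReal.ofReal_ne_top).symm
    _ ≤ ∫⁻ t in Icc 0 T, ENNReal.ofReal
          (E.toFun (chartAt (γ.toFun t)) (γ.toFun t)
            (derivWithin (fun s => (chartAt (γ.toFun t)).toFun (γ.toFun s)) (Icc 0 1) t)) := by
        refine setLIntegral_mono' measurableSet_Icc fun t ht => ?_
        have ht1 := hsub ht
        have ud : UniqueDiffWithinAt ℝ (Icc (0 : ℝ) 1) t := uniqueDiffOn_Icc_zero_one t ht1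
        have hd := ((hcd1 t ht).differentiableWithinAt one_ne_zero).hasDerivWithinAt
        have hψ := ((γ.contDiffWithinAt _ (chartAt_mem_atlas (γ.toFun t)) t ht1
          (mem_chartAt_source _)).differentiableWithinAt one_ne_zero).hasDerivWithinAt
        have hcont := γ.continuousOn t ht1
        rw [(hd.mono hsub).derivWithin (uniqueDiffOn_Icc hT0 t ht),
          E.toFun_eq_of_hasDerivWithinAt (chartAt_mem_atlas _) hφ (mem_chartAt_source _)
            (hN (hγ t ht)) ud hcont hψ hd, ← ofReal_norm, ← ENNReal.ofReal_mul hc.le]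
        exact ENNReal.ofReal_le_ofReal (hE _ (hγ t ht) _
          (φ.mem_tangentSpace_of_hasDerivWithinAt ud hcont hd))
    _ ≤ E.arcLength γ := lintegral_mono_set hsub

/-- An arc that is short compared to the distance, in a chart, of its origin to the boundary of a
good ball, stays in this ball. -/
theorem LengthFunction.arc_mem_source [T2Space M] (E : LengthFunction M) {φ : AnalyticChart M}
    (hφ : φ ∈ atlas (M := M)) {x : M} {r c : ℝ} (hc : 0 < c)
    (hK : IsCompact {y | y ∈ φ.source ∧ ‖φ.toFun y - φ.toFun x‖ ≤ r})
    (hE : ∀ y ∈ φ.source, ‖φ.toFun y - φ.toFun x‖ ≤ r →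
      ∀ v ∈ φ.tangentSpace y, c * ‖v‖ ≤ E.toFun φ y v)
    {y z : M} (γ : C1Arc y z) (hy : y ∈ φ.source)
    (hlen : E.arcLength γ < ENNReal.ofReal (c * (r - ‖φ.toFun y - φ.toFun x‖))) :
    z ∈ φ.source ∧ ENNReal.ofReal (c * ‖φ.toFun z - φ.toFun y‖) ≤ E.arcLength γ := by
  set N := {y | y ∈ φ.source ∧ ‖φ.toFun y - φ.toFun x‖ ≤ r} with hNdef
  set O := {y | y ∈ φ.source ∧ ‖φ.toFun y - φ.toFun x‖ < r} with hOdef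
  have hON : O ⊆ N := fun w hw => ⟨hw.1, hw.2.le⟩
  have hO : IsOpen O :=
    φ.continuousOn.isOpen_inter_preimage φ.isOpen_source
      (isOpen_lt (by fun_prop : Continuous fun w => ‖w - φ.toFun x‖) continuous_const)
  have hyO : y ∈ O := by
    have := ENNReal.ofReal_pos.1 (bot_le.trans_lt hlen)
    exact ⟨hy, sub_pos.1 (pos_of_mul_pos_right this hc.le)⟩
  have hEN : ∀ w ∈ N, ∀ v ∈ φ.tangentSpace w, c * ‖v‖ ≤ E.toFun φ w v :=
    fun w hw => hE w hw.1 hw.2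
  have hNs : N ⊆ φ.source := fun w hw => hw.1
  have hall : ∀ t ∈ Icc (0 : ℝ) 1, γ.toFun t ∈ O := by
    by_contra! hex
    -- `sInf S` is the first time at which the arc is outside the open ball
    set S := Icc (0 : ℝ) 1 ∩ γ.toFun ⁻¹' Oᶜ with hS
    have hSc : IsClosed S :=
      γ.continuousOn.preimage_isClosed_of_isClosed isClosed_Icc hO.isClosed_compl
    have hSne : S.Nonempty := let ⟨t, ht, h⟩ := hex; ⟨t, ht, h⟩
    have hSb : BddBelow S := ⟨0, fun t ht => ht.1.1⟩
    have hTS : sInf S ∈ S := hSc.csInf_mem hSne hSb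
    set T := sInf S with hT
    have hlt : ∀ t ∈ Ico 0 T, γ.toFun t ∈ O := by
      intro t ht
      by_contra hn
      exact (csInf_le hSb ⟨⟨ht.1, ht.2.le.trans hTS.1.2⟩, hn⟩).not_gt ht.2
    have hT0 : 0 < T := by
      refine hTS.1.1.lt_of_ne fun h => hTS.2 ?_
      rw [← h, γ.map_zero]
      exact hyO
    -- at that time the arc is still in the closed ball, which is closed in `M` by compactness
    have hTN : γ.toFun T ∈ N := by
      have h1 : ContinuousWithinAt γ.toFun (Ico 0 T) T :=
        (γ.continuousOn T hTS.1).mono fun t ht => ⟨ht.1, ht.2.le.trans hTS.1.2⟩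
      have h2 : T ∈ closure (Ico 0 T) := by
        rw [closure_Ico hT0.ne]
        exact right_mem_Icc.2 hT0.le
      have h3 := h1.mem_closure h2 (fun t ht => hON (hlt t ht) : MapsTo γ.toFun (Ico 0 T) N)
      rwa [hK.isClosed.closure_eq] at h3
    have h4 := E.norm_sub_le_arcLength hφ hNs hc hEN γ hTS.1 (by
      intro t ht
      rcases ht.2.eq_or_lt with rfl | h
      · exact hTN
      · exact hON (hlt t ⟨ht.1, h⟩))
    have h5 := (ENNReal.ofReal_lt_ofReal_iff_of_nonneg (by positivity)).1 (h4.trans_lt hlen)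
    have h6 := lt_of_mul_lt_mul_left h5 hc.le
    have h7 := norm_sub_le_norm_sub_add_norm_sub (φ.toFun (γ.toFun T)) (φ.toFun y) (φ.toFun x)
    exact hTS.2 ⟨hTN.1, by linarith⟩
  have h1 := E.norm_sub_le_arcLength hφ hNs hc hEN γ (right_mem_Icc.2 zero_le_one)
    (fun t ht => hON (hall t ht))
  have h2 := hall 1 (right_mem_Icc.2 zero_le_one)
  rw [γ.map_one] at h1 h2
  exact ⟨h2.1, h1⟩

/-- A piecewise `C¹` path that is short in the same sense stays in the good ball. -/
theorem LengthFunction.path_mem_ball [T2Space M] (E : LengthFunction M) {φ : AnalyticChart M}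
    (hφ : φ ∈ atlas (M := M)) {x : M} {r c : ℝ} (hc : 0 < c)
    (hK : IsCompact {y | y ∈ φ.source ∧ ‖φ.toFun y - φ.toFun x‖ ≤ r})
    (hE : ∀ y ∈ φ.source, ‖φ.toFun y - φ.toFun x‖ ≤ r →
      ∀ v ∈ φ.tangentSpace y, c * ‖v‖ ≤ E.toFun φ y v)
    {y z : M} (p : PiecewiseC1Path y z) (hy : y ∈ φ.source)
    (hlen : E.length p < ENNReal.ofReal (c * (r - ‖φ.toFun y - φ.toFun x‖))) :
    z ∈ φ.source ∧ ‖φ.toFun z - φ.toFun x‖ < r := by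
  induction p with
  | nil y =>
    have := ENNReal.ofReal_pos.1 (bot_le.trans_lt hlen)
    exact ⟨hy, sub_pos.1 (pos_of_mul_pos_right this hc.le)⟩
  | @cons y w z γ p ih =>
    simp only [LengthFunction.length] at hlen
    obtain ⟨hw, hle⟩ := E.arc_mem_source hφ hc hK hE γ hy (le_self_add.trans_lt hlen)
    refine ih hw ?_
    have h1 : ENNReal.ofReal (c * ‖φ.toFun w - φ.toFun y‖) + E.length p <
        ENNReal.ofReal (c * (r - ‖φ.toFun y - φ.toFun x‖)) :=
      lt_of_le_of_lt (by gcongr) hlen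
    rw [← lt_tsub_iff_left, ← ENNReal.ofReal_sub _ (by positivity), ← mul_sub] at h1
    refine h1.trans_le (ENNReal.ofReal_le_ofReal ?_)
    have h7 := norm_sub_le_norm_sub_add_norm_sub (φ.toFun w) (φ.toFun y) (φ.toFun x)
    exact mul_le_mul_of_nonneg_left (by linarith) hc.le

/-- The distance `d_E` controls the topology of `M`, uniformly near a point. -/
theorem LengthFunction.exists_dist_lt_imp_mem [T2Space M] (E : LengthFunction M) {x : M} {U : Set M}
    (hU : U ∈ 𝓝 x) : ∃ V ∈ 𝓝 x, ∃ δ : ℝ, 0 < δ ∧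
      ∀ y ∈ V, ∀ z, E.dist y z < ENNReal.ofReal δ → z ∈ U := by
  have hx := mem_chartAt_source x
  have hφ := chartAt_mem_atlas x
  obtain ⟨r, c, hr, hc, hK, hE⟩ := E.exists_good_ball hφ hx hU
  refine ⟨{y | y ∈ (chartAt x).source ∧ ‖(chartAt x).toFun y - (chartAt x).toFun x‖ < r / 2}, ?_,
    c * (r / 2), by positivity, ?_⟩
  · filter_upwards [(chartAt x).isOpen_source.mem_nhds hx,
      ((chartAt x).continuousAt hx).preimage_mem_nhds (ball_mem_nhds _ (half_pos hr))] with y h1 h2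
    exact ⟨h1, mem_ball_iff_norm.1 h2⟩
  · rintro y ⟨hy, hyr⟩ z hz
    obtain ⟨p, hp⟩ := iInf_lt_iff.1 hz
    have h1 := E.path_mem_ball hφ hc hK (fun y h1 h2 => (hE y h1 h2).2) p hy
      (hp.trans_le (ENNReal.ofReal_le_ofReal (by gcongr; linarith)))
    exact (hE z h1.1 h1.2.le).1

/-- Reversing an arc. -/
def C1Arc.reverse {x y : M} (γ : C1Arc x y) : C1Arc y x where
  toFun t := γ.toFun (1 - t)
  map_zero := by simp [γ.map_one]
  map_one := by simp [γ.map_zero]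
  continuousOn := γ.continuousOn.comp (by fun_prop) fun t ht =>
    ⟨by linarith [ht.2], by linarith [ht.1]⟩
  contDiffWithinAt φ hφ t ht hs :=
    ContDiffWithinAt.comp (g := fun s => φ.toFun (γ.toFun s)) (f := fun s : ℝ => 1 - s) t
      (γ.contDiffWithinAt φ hφ (1 - t) ⟨by linarith [ht.2], by linarith [ht.1]⟩ hs)
      (by fun_prop) fun t ht => ⟨by linarith [ht.2], by linarith [ht.1]⟩

theorem LengthFunction.arcLength_reverse (E : LengthFunction M) {x y : M} (γ : C1Arc x y) :
    E.arcLength γ.reverse = E.arcLength γ := by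
  set G : ℝ → ℝ≥0∞ := fun t => ENNReal.ofReal
    (E.toFun (chartAt (γ.toFun t)) (γ.toFun t)
      (derivWithin (fun s => (chartAt (γ.toFun t)).toFun (γ.toFun s)) (Icc 0 1) t)) with hG
  have hpre : (fun t : ℝ => 1 - t) ⁻¹' Icc 0 1 = Icc 0 1 := by simp
  have h1 : E.arcLength γ.reverse = ∫⁻ t in Icc (0 : ℝ) 1, G (1 - t) := by
    refine setLIntegral_congr_fun measurableSet_Icc fun t ht => ?_
    have ht' : 1 - t ∈ Icc (0 : ℝ) 1 := ⟨by linarith [ht.2], by linarith [ht.1]⟩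
    have hφ := chartAt_mem_atlas (γ.toFun (1 - t))
    have hs := mem_chartAt_source (γ.toFun (1 - t))
    set φ := chartAt (γ.toFun (1 - t))
    have ud := uniqueDiffOn_Icc_zero_one (1 - t) ht'
    have hd := ((γ.contDiffWithinAt φ hφ (1 - t) ht' hs).differentiableWithinAt
      one_ne_zero).hasDerivWithinAt
    have hr : HasDerivWithinAt (fun s : ℝ => 1 - s) (-1) (Icc 0 1) t := by
      simpa using ((hasDerivAt_id t).const_sub 1).hasDerivWithinAt
    have h2 := HasDerivWithinAt.scomp (g₁ := fun s => φ.toFun (γ.toFun s))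
      (h := fun s : ℝ => 1 - s) t hd hr (fun t ht => ⟨by linarith [ht.2], by linarith [ht.1]⟩)
    have h3 : derivWithin (fun s => φ.toFun (γ.toFun (1 - s))) (Icc 0 1) t =
        (-1 : ℂ) • derivWithin (fun s => φ.toFun (γ.toFun s)) (Icc 0 1) (1 - t) := by
      rw [show (fun s => φ.toFun (γ.toFun (1 - s))) =
        (fun s => φ.toFun (γ.toFun s)) ∘ fun s : ℝ => 1 - s from rfl,
        h2.derivWithin (uniqueDiffOn_Icc_zero_one t ht)]
      simp
    change ENNReal.ofReal (E.toFun φ (γ.toFun (1 - t))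
        (derivWithin (fun s => φ.toFun (γ.toFun (1 - s))) (Icc 0 1) t)) =
      ENNReal.ofReal (E.toFun φ (γ.toFun (1 - t))
        (derivWithin (fun s => φ.toFun (γ.toFun s)) (Icc 0 1) (1 - t)))
    rw [h3, E.map_smul φ hφ _ hs _
      (φ.mem_tangentSpace_of_hasDerivWithinAt ud (γ.continuousOn _ ht') hd)]
    simp
  rw [h1]
  have h2 := (Measure.measurePreserving_sub_left volume (1 : ℝ)).setLIntegral_comp_preimage_emb
    (MeasurableEquiv.subLeft (1 : ℝ)).measurableEmbedding G (Icc 0 1)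
  rw [hpre] at h2
  exact h2

theorem LengthFunction.exists_path_snoc (E : LengthFunction M) {x y z : M}
    (p : PiecewiseC1Path x y) (γ : C1Arc y z) :
    ∃ q : PiecewiseC1Path x z, E.length q = E.length p + E.arcLength γ := by
  induction p with
  | nil x => exact ⟨.cons γ (.nil _), by simp [LengthFunction.length]⟩
  | cons γ' p ih =>
    obtain ⟨q, hq⟩ := ih γ
    exact ⟨.cons γ' q, by simp only [LengthFunction.length, hq, add_assoc]⟩

theorem LengthFunction.exists_path_reverse (E : LengthFunction M) {x y : M}
    (p : PiecewiseC1Path x y) : ∃ q : PiecewiseC1Path y x, E.length q = E.length p := by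
  induction p with
  | nil x => exact ⟨.nil x, rfl⟩
  | cons γ p ih =>
    obtain ⟨q, hq⟩ := ih
    obtain ⟨q', hq'⟩ := E.exists_path_snoc q γ.reverse
    exact ⟨q', by rw [hq', hq, E.arcLength_reverse, LengthFunction.length, add_comm]⟩

theorem LengthFunction.dist_comm (E : LengthFunction M) (x y : M) : E.dist x y = E.dist y x := by
  have key : ∀ x y : M, E.dist x y ≤ E.dist y x := fun x y => le_iInf fun p => by
    obtain ⟨q, hq⟩ := E.exists_path_reverse p
    exact (iInf_le _ q).trans hq.le
  exact (key x y).antisymm (key y x)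

/-- A family at `d_E`-distance tending to `0` from one that converges in `M` has the same limit. -/
theorem LengthFunction.tendsto_of_tendsto_dist [T2Space M] (E : LengthFunction M) {ι : Type*}
    {l : Filter ι} {u v : ι → M} {x : M} (hu : Tendsto u l (𝓝 x))
    (h : Tendsto (fun i => E.dist (u i) (v i)) l (𝓝 0)) : Tendsto v l (𝓝 x) := by
  intro U hU
  obtain ⟨V, hV, δ, hδ, hVU⟩ := E.exists_dist_lt_imp_mem hU
  rw [mem_map]
  filter_upwards [hu hV, h.eventually (gt_mem_nhds (ENNReal.ofReal_pos.2 hδ))] with i h1 h2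
  exact hVU _ h1 _ h2

end Paths

/-! ### Holomorphic maps and their speed -/

section Holomorphic

variable {M : Type*} [TopologicalSpace M] [ReducedComplexSpace M]

/-- Holomorphy on an open set `S` of a map defined on all of `ℂ`, with irrelevant values off `S`:
continuity, and holomorphy in the charts. -/
def HolOn (f : ℂ → M) (S : Set ℂ) : Prop :=
  ContinuousOn f S ∧ ∀ φ ∈ atlas (M := M), ∀ z ∈ S, f z ∈ φ.source →
    DifferentiableAt ℂ (fun w => φ.toFun (f w)) z

/-- The length of the derivative of a holomorphic map, read in the preferred chart. -/
noncomputable def LengthFunction.speed (E : LengthFunction M) (f : ℂ → M) (z : ℂ) : ℝ :=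
  E.toFun (chartAt (f z)) (f z) (deriv (fun w => (chartAt (f z)).toFun (f w)) z)

variable {f : ℂ → M} {S : Set ℂ} {z : ℂ}

theorem HolOn.mono (hf : HolOn f S) {S' : Set ℂ} (h : S' ⊆ S) : HolOn f S' :=
  ⟨hf.1.mono h, fun φ hφ z hz => hf.2 φ hφ z (h hz)⟩

theorem HolOn.continuousAt (hf : HolOn f S) (hS : IsOpen S) (hz : z ∈ S) : ContinuousAt f z :=
  hf.1.continuousAt (hS.mem_nhds hz)

theorem HolOn.eventually_mem (hf : HolOn f S) (hS : IsOpen S) (hz : z ∈ S) {φ : AnalyticChart M}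
    (hzφ : f z ∈ φ.source) : ∀ᶠ w in 𝓝 z, w ∈ S ∧ f w ∈ φ.source :=
  (show ∀ᶠ w in 𝓝 z, w ∈ S from hS.mem_nhds hz).and
    ((hf.continuousAt hS hz).eventually (φ.isOpen_source.mem_nhds hzφ))

theorem HolOn.analyticAt (hf : HolOn f S) (hS : IsOpen S) (hz : z ∈ S) {φ : AnalyticChart M}
    (hφ : φ ∈ atlas (M := M)) (hzφ : f z ∈ φ.source) :
    AnalyticAt ℂ (fun w => φ.toFun (f w)) z :=
  Complex.analyticAt_iff_eventually_differentiableAt.2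
    ((hf.eventually_mem hS hz hzφ).mono fun w hw => hf.2 φ hφ w hw.1 hw.2)

theorem HolOn.deriv_mem_tangentSpace (hf : HolOn f S) (hS : IsOpen S) (hz : z ∈ S)
    {φ : AnalyticChart M} (hφ : φ ∈ atlas (M := M)) (hzφ : f z ∈ φ.source) :
    deriv (fun w => φ.toFun (f w)) z ∈ φ.tangentSpace (f z) :=
  φ.mem_tangentSpace_of_hasDerivWithinAt uniqueDiffWithinAt_univ
    (hf.continuousAt hS hz).continuousWithinAt
    (hf.2 φ hφ z hz hzφ).hasDerivAt.hasDerivWithinAt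

theorem HolOn.speed_eq (hf : HolOn f S) (E : LengthFunction M) (hS : IsOpen S) (hz : z ∈ S)
    {φ : AnalyticChart M} (hφ : φ ∈ atlas (M := M)) (hzφ : f z ∈ φ.source) :
    E.speed f z = E.toFun φ (f z) (deriv (fun w => φ.toFun (f w)) z) :=
  E.toFun_eq_of_hasDerivWithinAt (chartAt_mem_atlas _) hφ (mem_chartAt_source _) hzφ
    uniqueDiffWithinAt_univ (hf.continuousAt hS hz).continuousWithinAt
    (hf.2 _ (chartAt_mem_atlas _) z hz (mem_chartAt_source _)).hasDerivAt.hasDerivWithinAt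
    (hf.2 φ hφ z hz hzφ).hasDerivAt.hasDerivWithinAt

theorem HolOn.speed_nonneg (hf : HolOn f S) (E : LengthFunction M) (hS : IsOpen S) (hz : z ∈ S) :
    0 ≤ E.speed f z :=
  E.nonneg _ (chartAt_mem_atlas _) _ (mem_chartAt_source _) _
    (hf.deriv_mem_tangentSpace hS hz (chartAt_mem_atlas _) (mem_chartAt_source _))

theorem HolOn.continuousAt_speed (hf : HolOn f S) (E : LengthFunction M) (hS : IsOpen S)
    (hz : z ∈ S) : ContinuousAt (E.speed f) z := by
  have hφ := chartAt_mem_atlas (f z)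
  have hzφ := mem_chartAt_source (f z)
  set φ := chartAt (f z)
  have hev := hf.eventually_mem hS hz hzφ
  have h1 : E.speed f =ᶠ[𝓝 z]
      fun w => E.toFun φ (f w) (deriv (fun u => φ.toFun (f u)) w) :=
    hev.mono fun w hw => hf.speed_eq E hS hw.1 hφ hw.2
  refine ContinuousAt.congr ?_ h1.symm
  have h2 : Tendsto (fun w => (f w, deriv (fun u => φ.toFun (f u)) w)) (𝓝 z)
      (𝓝[{q | q.1 ∈ φ.source ∧ q.2 ∈ φ.tangentSpace q.1}]
        (f z, deriv (fun u => φ.toFun (f u)) z)) := by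
    refine tendsto_nhdsWithin_iff.2 ⟨?_, ?_⟩
    · exact (hf.continuousAt hS hz).prodMk_nhds
        (hf.analyticAt hS hz hφ hzφ).deriv.continuousAt
    · exact hev.mono fun w hw => ⟨hw.2, hf.deriv_mem_tangentSpace hS hw.1 hφ hw.2⟩
  exact (E.continuousOn φ hφ _ ⟨hzφ, hf.deriv_mem_tangentSpace hS hz hφ hzφ⟩).tendsto.comp h2

theorem HolOn.comp_affine (hf : HolOn f S) (a : ℂ) (b : ℂ) :
    HolOn (fun ξ => f (a + b * ξ)) ((fun ξ => a + b * ξ) ⁻¹' S) := by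
  refine ⟨hf.1.comp (by fun_prop) (mapsTo_preimage _ _), fun φ hφ ξ hξ hs => ?_⟩
  exact DifferentiableAt.comp (g := fun w => φ.toFun (f w)) (f := fun ξ => a + b * ξ) ξ
    (hf.2 φ hφ _ hξ hs) (by fun_prop)

theorem HolOn.speed_comp_affine (hf : HolOn f S) (E : LengthFunction M) (hS : IsOpen S) (a b : ℂ)
    (hz : a + b * z ∈ S) :
    E.speed (fun ξ => f (a + b * ξ)) z = ‖b‖ * E.speed f (a + b * z) := by
  have hφ := chartAt_mem_atlas (f (a + b * z))
  have hzφ := mem_chartAt_source (f (a + b * z))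
  simp only [LengthFunction.speed]
  set φ := chartAt (f (a + b * z))
  have h1 : HasDerivAt (fun ξ : ℂ => a + b * ξ) b z := by
    simpa using ((hasDerivAt_id z).const_mul b).const_add a
  have h2 := HasDerivAt.scomp (g₁ := fun w => φ.toFun (f w)) (h := fun ξ => a + b * ξ) z
    (hf.2 φ hφ _ hz hzφ).hasDerivAt h1
  have h3 : deriv (fun w => φ.toFun (f (a + b * w))) z =
      b • deriv (fun w => φ.toFun (f w)) (a + b * z) := h2.deriv
  rw [h3, E.map_smul φ hφ _ hzφ _ (hf.deriv_mem_tangentSpace hS hz hφ hzφ)]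

/-- A holomorphic map is Lipschitz for `d_E` on convex sets where its speed is bounded. -/
theorem HolOn.dist_le (hf : HolOn f S) (E : LengthFunction M) (hS : IsOpen S) (hconv : Convex ℝ S)
    {C : ℝ} (hC : ∀ z ∈ S, E.speed f z ≤ C) {w : ℂ} (hz : z ∈ S) (hw : w ∈ S) :
    E.dist (f z) (f w) ≤ ENNReal.ofReal (C * ‖w - z‖) := by
  have hmem : ∀ t ∈ Icc (0 : ℝ) 1, z + (w - z) * (t : ℂ) ∈ S := fun t ht => by
    have := hconv.add_smul_sub_mem hz hw ht
    rwa [Complex.real_smul, mul_comm] at this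
  have hd : ∀ t : ℝ, HasDerivAt (fun t : ℝ => z + (w - z) * (t : ℂ)) (w - z) t := fun t => by
    simpa using ((Complex.ofRealCLM.hasDerivAt (x := t)).const_mul (w - z)).const_add z
  have hcd : ContDiff ℝ 1 (fun t : ℝ => z + (w - z) * (t : ℂ)) :=
    contDiff_const.add (contDiff_const.mul Complex.ofRealCLM.contDiff)
  let γ : C1Arc (f z) (f w) :=
    { toFun := fun t => f (z + (w - z) * (t : ℂ))
      map_zero := by simp
      map_one := by simp
      continuousOn := hf.1.comp hcd.continuous.continuousOn hmem
      contDiffWithinAt := fun φ hφ t ht hs =>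
        (ContDiffAt.comp (g := fun u => φ.toFun (f u)) (f := fun t : ℝ => z + (w - z) * (t : ℂ)) t
          ((hf.analyticAt hS (hmem t ht) hφ hs).contDiffAt.restrict_scalars ℝ)
          hcd.contDiffAt).contDiffWithinAt }
  have hlen : E.arcLength γ ≤ ENNReal.ofReal (C * ‖w - z‖) := by
    calc E.arcLength γ ≤ ∫⁻ _ in Icc (0 : ℝ) 1, ENNReal.ofReal (C * ‖w - z‖) := by
          refine setLIntegral_mono' measurableSet_Icc fun t ht => ENNReal.ofReal_le_ofReal ?_
          have hφ := chartAt_mem_atlas (γ.toFun t)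
          have hzφ := mem_chartAt_source (γ.toFun t)
          set φ := chartAt (γ.toFun t)
          have h2 := HasDerivAt.scomp (g₁ := fun u => φ.toFun (f u))
            (h := fun t : ℝ => z + (w - z) * (t : ℂ)) t
            (hf.2 φ hφ _ (hmem t ht) hzφ).hasDerivAt (hd t)
          have h3 : derivWithin (fun s => φ.toFun (γ.toFun s)) (Icc 0 1) t =
              (w - z) • deriv (fun u => φ.toFun (f u)) (z + (w - z) * (t : ℂ)) :=
            h2.hasDerivWithinAt.derivWithin (uniqueDiffOn_Icc_zero_one t ht)
          rw [h3, E.map_smul φ hφ _ hzφ _ (hf.deriv_mem_tangentSpace hS (hmem t ht) hφ hzφ),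
            mul_comm]
          exact mul_le_mul_of_nonneg_right (hC _ (hmem t ht)) (norm_nonneg _)
      _ = ENNReal.ofReal (C * ‖w - z‖) := by simp
  refine (iInf_le _ (PiecewiseC1Path.cons γ (PiecewiseC1Path.nil _))).trans ?_
  simpa [LengthFunction.length] using hlen

end Holomorphic

/-! ### Limits of holomorphic maps with bounded speed -/

section Limits

variable {M : Type*} [TopologicalSpace M] {ι : Type*}

theorem IsCompact.exists_tendsto_ultrafilter {K : Set M} (hK : IsCompact K) (𝒰 : Ultrafilter ι)
    {u : ι → M} (hu : ∀ᶠ i in (𝒰 : Filter ι), u i ∈ K) :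
    ∃ x ∈ K, Tendsto u 𝒰 (𝓝 x) :=
  hK.ultrafilter_le_nhds' (𝒰.map u) hu

theorem tendstoLocallyUniformlyOn_of_lipschitz {X V : Type*} [PseudoMetricSpace X]
    [PseudoMetricSpace V] {l : Filter ι} [l.NeBot] {F : ι → X → V} {G : X → V} {B : Set X} {L : ℝ}
    (hL : ∀ᶠ i in l, ∀ x ∈ B, ∀ y ∈ B, dist (F i x) (F i y) ≤ L * dist x y)
    (hG : ∀ x ∈ B, Tendsto (fun i => F i x) l (𝓝 (G x))) :
    TendstoLocallyUniformlyOn F G l B := by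
  rw [Metric.tendstoLocallyUniformlyOn_iff]
  intro ε hε x hx
  have hGL : ∀ y ∈ B, dist (G x) (G y) ≤ L * dist x y := fun y hy =>
    le_of_tendsto ((hG x hx).dist (hG y hy)) (hL.mono fun i hi => hi x hx y hy)
  have hpos : 0 < ε / (3 * (|L| + 1)) := by positivity
  refine ⟨ball x (ε / (3 * (|L| + 1))) ∩ B,
    inter_mem (mem_nhdsWithin_of_mem_nhds (ball_mem_nhds _ hpos)) self_mem_nhdsWithin, ?_⟩
  filter_upwards [hL, Metric.tendsto_nhds.1 (hG x hx) (ε / 3) (by positivity)] with i h1 h2 y hy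
  have hxy : L * dist x y ≤ ε / 3 := by
    have h3 : dist x y < ε / (3 * (|L| + 1)) := by rw [dist_comm]; exact hy.1
    rw [lt_div_iff₀ (by positivity)] at h3
    nlinarith [le_abs_self L, dist_nonneg (x := x) (y := y)]
  have h4 := h1 x hx y hy.2
  have h5 := hGL y hy.2
  have h6 := dist_triangle4 (G y) (G x) (F i x) (F i y)
  rw [dist_comm (G y) (G x), dist_comm (G x) (F i x)] at h6
  linarith

variable [ReducedComplexSpace M] [T2Space M] (E : LengthFunction M)

/-- A family of holomorphic maps with bounded speed is equicontinuous at a point where it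
converges. -/
theorem LengthFunction.eventually_forall_ball_mem {l : Filter ι} {f : ι → ℂ → M} {z : ℂ} {R C : ℝ}
    (hR : 0 < R) (hf : ∀ᶠ i in l, HolOn (f i) (ball z R) ∧ ∀ w ∈ ball z R, E.speed (f i) w ≤ C)
    {x : M} (hx : Tendsto (fun i => f i z) l (𝓝 x)) {U : Set M} (hU : U ∈ 𝓝 x) :
    ∃ ρ : ℝ, 0 < ρ ∧ ∀ᶠ i in l, ∀ w ∈ ball z ρ, f i w ∈ U := by
  obtain ⟨V, hV, δ, hδ, hVU⟩ := E.exists_dist_lt_imp_mem hU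
  refine ⟨min R (δ / (|C| + 1)), by positivity, ?_⟩
  filter_upwards [hf, hx hV] with i h1 h2 w hw
  refine hVU _ h2 _ ((h1.1.dist_le E isOpen_ball (convex_ball z R) h1.2 (mem_ball_self hR)
    (ball_subset_ball (min_le_left _ _) hw)).trans_lt ((ENNReal.ofReal_lt_ofReal_iff hδ).2 ?_))
  have h3 : ‖w - z‖ < δ / (|C| + 1) := by
    rw [← dist_eq_norm]
    exact lt_of_lt_of_le hw (min_le_right _ _)
  rw [lt_div_iff₀ (by positivity)] at h3
  nlinarith [le_abs_self C, norm_nonneg (w - z)]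

/-- Along an ultrafilter, the set of convergence of maps with locally bounded speed is open. -/
theorem LengthFunction.exists_ball_tendsto (𝒰 : Ultrafilter ι) {f : ι → ℂ → M} {z : ℂ} {R C : ℝ}
    (hR : 0 < R)
    (hf : ∀ᶠ i in (𝒰 : Filter ι), HolOn (f i) (ball z R) ∧ ∀ w ∈ ball z R, E.speed (f i) w ≤ C)
    {x : M} (hx : Tendsto (fun i => f i z) 𝒰 (𝓝 x)) :
    ∃ ρ : ℝ, 0 < ρ ∧ ∀ w ∈ ball z ρ, ∃ y, Tendsto (fun i => f i w) 𝒰 (𝓝 y) := by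
  have : LocallyCompactSpace M := locallyCompactSpace_of_reducedComplexSpace
  obtain ⟨K, hK, hKx⟩ := exists_compact_mem_nhds x
  obtain ⟨ρ, hρ, h⟩ := E.eventually_forall_ball_mem hR hf hx hKx
  refine ⟨ρ, hρ, fun w hw => ?_⟩
  obtain ⟨y, -, hy⟩ := hK.exists_tendsto_ultrafilter 𝒰 (h.mono fun i hi => hi w hw)
  exact ⟨y, hy⟩

/-- Local boundedness, along a filter, of the speed of maps that are eventually holomorphic. -/
def LengthFunction.LocallyBoundedSpeed (f : ι → ℂ → M) (l : Filter ι) (S : Set ℂ) : Prop :=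
  ∀ z ∈ S, ∃ R C : ℝ, 0 < R ∧
    ∀ᶠ i in l, HolOn (f i) (ball z R) ∧ ∀ w ∈ ball z R, E.speed (f i) w ≤ C

variable {E} {l : Filter ι} [l.NeBot] {f : ι → ℂ → M} {g : ℂ → M} {S : Set ℂ}

theorem LengthFunction.LocallyBoundedSpeed.continuousOn (hf : E.LocallyBoundedSpeed f l S)
    (hg : ∀ z ∈ S, Tendsto (fun i => f i z) l (𝓝 (g z))) : ContinuousOn g S := by
  have : LocallyCompactSpace M := locallyCompactSpace_of_reducedComplexSpace
  intro z hz U hU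
  obtain ⟨K, hK, hKc, hKU⟩ := exists_mem_nhds_isClosed_subset hU
  obtain ⟨R, C, hR, hRC⟩ := hf z hz
  obtain ⟨ρ, hρ, h⟩ := E.eventually_forall_ball_mem hR hRC (hg z hz) hK
  rw [mem_map]
  filter_upwards [self_mem_nhdsWithin, mem_nhdsWithin_of_mem_nhds (ball_mem_nhds z hρ)] with w h1 h2
  exact hKU (hKc.mem_of_tendsto (hg w h1) (h.mono fun i hi => hi w h2))

/-- In a chart, the limit is holomorphic and the derivatives converge to its derivative. -/
theorem LengthFunction.LocallyBoundedSpeed.tendsto_deriv (hf : E.LocallyBoundedSpeed f l S)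
    (hS : IsOpen S) (hg : ∀ z ∈ S, Tendsto (fun i => f i z) l (𝓝 (g z))) {φ : AnalyticChart M}
    (hφ : φ ∈ atlas (M := M)) {z : ℂ} (hz : z ∈ S) (hzφ : g z ∈ φ.source) :
    DifferentiableAt ℂ (fun w => φ.toFun (g w)) z ∧
      Tendsto (fun i => deriv (fun w => φ.toFun (f i w)) z) l
        (𝓝 (deriv (fun w => φ.toFun (g w)) z)) := by
  obtain ⟨R, C, hR, hRC⟩ := hf z hz
  obtain ⟨c, hc, hcE⟩ := E.eventually_norm_le hφ hzφ
  obtain ⟨ρ₁, hρ₁, h₁⟩ := E.eventually_forall_ball_mem hR hRC (hg z hz)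
    (inter_mem (φ.isOpen_source.mem_nhds hzφ) hcE)
  have hgc : ContinuousAt g z := (hf.continuousOn hg).continuousAt (hS.mem_nhds hz)
  obtain ⟨ρ₂, hρ₂, h₂⟩ := Metric.mem_nhds_iff.1
    (inter_mem (hS.mem_nhds hz) (hgc.preimage_mem_nhds (φ.isOpen_source.mem_nhds hzφ)))
  set ρ := min R (min ρ₁ ρ₂) with hρ
  have hρ0 : 0 < ρ := lt_min hR (lt_min hρ₁ hρ₂)
  have b1 : ball z ρ ⊆ ball z R := ball_subset_ball (min_le_left _ _)
  have b2 : ball z ρ ⊆ ball z ρ₁ := ball_subset_ball ((min_le_right _ _).trans (min_le_left _ _))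
  have b3 : ball z ρ ⊆ ball z ρ₂ := ball_subset_ball ((min_le_right _ _).trans (min_le_right _ _))
  have hdiff : ∀ᶠ i in l, DifferentiableOn ℂ (fun w => φ.toFun (f i w)) (ball z ρ) := by
    filter_upwards [hRC, h₁] with i hi1 hi2 w hw
    exact (hi1.1.2 φ hφ w (b1 hw) (hi2 w (b2 hw)).1).differentiableWithinAt
  have hlip : ∀ᶠ i in l, ∀ x ∈ ball z ρ, ∀ y ∈ ball z ρ,
      Dist.dist (φ.toFun (f i x)) (φ.toFun (f i y)) ≤ C / c * Dist.dist x y := by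
    filter_upwards [hRC, h₁] with i hi1 hi2 x hx y hy
    rw [_root_.dist_comm, _root_.dist_comm x, dist_eq_norm, dist_eq_norm]
    refine (convex_ball z ρ).norm_image_sub_le_of_norm_deriv_le
      (f := fun w => φ.toFun (f i w)) (fun w hw => hi1.1.2 φ hφ w (b1 hw) (hi2 w (b2 hw)).1)
      (fun w hw => ?_) hx hy
    rw [le_div_iff₀' hc]
    have hs := (hi2 w (b2 hw)).1
    refine ((hi2 w (b2 hw)).2 _
      (hi1.1.deriv_mem_tangentSpace isOpen_ball (b1 hw) hφ hs)).trans ?_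
    rw [← hi1.1.speed_eq E isOpen_ball (b1 hw) hφ hs]
    exact hi1.2 w (b1 hw)
  have hunif : TendstoLocallyUniformlyOn (fun i w => φ.toFun (f i w)) (fun w => φ.toFun (g w)) l
      (ball z ρ) :=
    tendstoLocallyUniformlyOn_of_lipschitz hlip fun w hw =>
      (φ.continuousAt (h₂ (b3 hw)).2).tendsto.comp (hg w (h₂ (b3 hw)).1)
  exact ⟨(hunif.differentiableOn hdiff isOpen_ball).differentiableAt (ball_mem_nhds z hρ0),
    (hunif.deriv hdiff isOpen_ball).tendsto_at (mem_ball_self hρ0)⟩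

theorem LengthFunction.LocallyBoundedSpeed.holOn (hf : E.LocallyBoundedSpeed f l S)
    (hS : IsOpen S) (hg : ∀ z ∈ S, Tendsto (fun i => f i z) l (𝓝 (g z))) : HolOn g S :=
  ⟨hf.continuousOn hg, fun _ hφ _ hz hzφ => (hf.tendsto_deriv hS hg hφ hz hzφ).1⟩

theorem LengthFunction.LocallyBoundedSpeed.tendsto_speed (hf : E.LocallyBoundedSpeed f l S)
    (hS : IsOpen S) (hg : ∀ z ∈ S, Tendsto (fun i => f i z) l (𝓝 (g z))) {z : ℂ} (hz : z ∈ S) :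
    Tendsto (fun i => E.speed (f i) z) l (𝓝 (E.speed g z)) := by
  have hφ := chartAt_mem_atlas (g z)
  have hzφ := mem_chartAt_source (g z)
  set φ := chartAt (g z)
  obtain ⟨R, C, hR, hRC⟩ := hf z hz
  have hev : ∀ᶠ i in l, HolOn (f i) (ball z R) ∧ f i z ∈ φ.source :=
    (hRC.mono fun i hi => hi.1).and ((hg z hz).eventually (φ.isOpen_source.mem_nhds hzφ))
  have hT := (hf.holOn hS hg).deriv_mem_tangentSpace hS hz hφ hzφ
  have h2 : Tendsto (fun i => (f i z, deriv (fun u => φ.toFun (f i u)) z)) l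
      (𝓝[{q | q.1 ∈ φ.source ∧ q.2 ∈ φ.tangentSpace q.1}]
        (g z, deriv (fun u => φ.toFun (g u)) z)) := by
    refine tendsto_nhdsWithin_iff.2 ⟨?_, ?_⟩
    · exact (hg z hz).prodMk_nhds (hf.tendsto_deriv hS hg hφ hz hzφ).2
    · exact hev.mono fun i hi =>
        ⟨hi.2, hi.1.deriv_mem_tangentSpace isOpen_ball (mem_ball_self hR) hφ hi.2⟩
  refine ((E.continuousOn φ hφ _ ⟨hzφ, hT⟩).tendsto.comp h2).congr' ?_
  exact hev.mono fun i hi => (hi.1.speed_eq E isOpen_ball (mem_ball_self hR) hφ hi.2).symm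

/-- The form in which completeness is used: entire limits. Maps of bounded speed on larger and
larger discs that converge at one point, along an ultrafilter, converge everywhere. The limit on a
maximal disc of convergence has finite length along the radius to a boundary point, so it has an
endpoint by completeness, and a compact neighbourhood of this endpoint captures the maps at the
boundary point. -/
theorem LengthFunction.IsComplete.exists_tendsto (hE : E.IsComplete) (𝒰 : Ultrafilter ι)
    {f : ι → ℂ → M} {C : ℝ}
    (hf : ∀ R : ℝ, ∀ᶠ i in (𝒰 : Filter ι),
      HolOn (f i) (ball 0 R) ∧ ∀ w ∈ ball 0 R, E.speed (f i) w ≤ C)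
    {z₀ : ℂ} {x : M} (hx : Tendsto (fun i => f i z₀) 𝒰 (𝓝 x)) (z : ℂ) :
    ∃ y, Tendsto (fun i => f i z) 𝒰 (𝓝 y) := by
  have : LocallyCompactSpace M := locallyCompactSpace_of_reducedComplexSpace
  have hball : ∀ z : ℂ, ball z 1 ⊆ ball 0 (‖z‖ + 1) := fun z =>
    ball_subset_ball' (by rw [dist_zero_right, add_comm])
  have hf' : ∀ z : ℂ, ∀ᶠ i in (𝒰 : Filter ι),
      HolOn (f i) (ball z 1) ∧ ∀ w ∈ ball z 1, E.speed (f i) w ≤ C := fun z =>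
    (hf (‖z‖ + 1)).mono fun i hi => ⟨hi.1.mono (hball z), fun w hw => hi.2 w (hball z hw)⟩
  have hlb : E.LocallyBoundedSpeed f 𝒰 univ := fun z _ => ⟨1, C, one_pos, hf' z⟩
  set S := {z | ∃ y, Tendsto (fun i => f i z) 𝒰 (𝓝 y)} with hSdef
  have hSo : IsOpen S := by
    rw [Metric.isOpen_iff]
    rintro w ⟨y, hy⟩
    exact E.exists_ball_tendsto 𝒰 one_pos (hf' w) hy
  by_contra hzS
  have hz₀S : z₀ ∈ S := ⟨x, hx⟩
  -- `ball z₀ d` is the largest disc of convergence around `z₀`, and `z₁` a boundary point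
  obtain ⟨z₁, hz₁, hd⟩ := hSo.isClosed_compl.exists_infDist_eq_dist ⟨z, hzS⟩ z₀
  set d := Dist.dist z₀ z₁ with hd_def
  have hd0 : 0 < d := dist_pos.2 fun h => hz₁ (h ▸ hz₀S)
  have hBS : ball z₀ d ⊆ S := by
    intro w hw
    by_contra hwS
    have h1 := infDist_le_dist_of_mem (x := z₀) (show w ∈ Sᶜ from hwS)
    rw [hd, _root_.dist_comm] at h1
    exact (mem_ball.1 hw).not_ge h1
  have : Nonempty M := ⟨x⟩
  choose! g hg using fun w (hw : w ∈ S) => hw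
  have hlbS : E.LocallyBoundedSpeed f 𝒰 S := fun w _ => hlb w (mem_univ w)
  have hgh : HolOn g S := hlbS.holOn hSo hg
  have hgs : ∀ w ∈ S, E.speed g w ≤ C := fun w hw =>
    le_of_tendsto (hlbS.tendsto_speed hSo hg hw) ((hf' w).mono fun i hi =>
      hi.2 w (mem_ball_self one_pos))
  -- points of the open radius from `z₀` to `z₁`, converging to `z₁`
  set p : ℕ → ℂ := fun n => z₁ + ((1 / ((n : ℝ) + 1) : ℝ) : ℂ) * ((z₀ - z₁) / 2) with hp
  have hps : Tendsto p atTop (𝓝 z₁) := by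
    have h1 : Tendsto (fun n : ℕ => ((1 / ((n : ℝ) + 1) : ℝ) : ℂ)) atTop (𝓝 ((0 : ℝ) : ℂ)) :=
      (Complex.continuous_ofReal.tendsto 0).comp tendsto_one_div_add_atTop_nhds_zero_nat
    simpa [hp] using (h1.mul_const ((z₀ - z₁) / 2)).const_add z₁
  have hpB : ∀ n, p n ∈ ball z₀ d := by
    intro n
    have ht0 : 0 < 1 / ((n : ℝ) + 1) := by positivity
    have ht1 : 1 / ((n : ℝ) + 1) ≤ 1 := by
      rw [div_le_one (by positivity)]
      linarith [(Nat.cast_nonneg n : (0 : ℝ) ≤ n)]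
    set t := 1 / ((n : ℝ) + 1) with ht
    have e : p n - z₀ = ((1 - t / 2 : ℝ) : ℂ) * (z₁ - z₀) := by
      simp only [hp, ← ht]
      push_cast
      ring
    rw [mem_ball, dist_eq_norm, e, norm_mul, Complex.norm_real, Real.norm_of_nonneg (by linarith),
      ← dist_eq_norm, _root_.dist_comm z₁, ← hd_def]
    nlinarith
  have hdist : Tendsto (fun q : ℕ × ℕ => ENNReal.ofReal (C * ‖p q.2 - p q.1‖)) atTop (𝓝 0) := by
    have h1 : Tendsto (fun q : ℕ × ℕ => C * ‖p q.2 - p q.1‖) atTop (𝓝 (C * ‖z₁ - z₁‖)) := by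
      rw [← prod_atTop_atTop_eq]
      exact ((hps.comp tendsto_snd).sub (hps.comp tendsto_fst)).norm.const_mul C
    simpa [Function.comp_def] using (ENNReal.continuous_ofReal.tendsto _).comp h1
  -- the limit has a `d_E`-limit `y` along the radius
  obtain ⟨y, hy⟩ := hE (fun n => g (p n)) (by
    intro ε hε
    obtain ⟨⟨N₁, N₂⟩, hN⟩ := eventually_atTop.1 (hdist.eventually (gt_mem_nhds hε))
    refine ⟨max N₁ N₂, fun m hm n hn => ?_⟩
    exact ((hgh.mono hBS).dist_le E isOpen_ball (convex_ball z₀ d) (fun w hw => hgs w (hBS hw))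
      (hpB m) (hpB n)).trans_lt
      (hN (m, n) ⟨(le_max_left _ _).trans hm, (le_max_right _ _).trans hn⟩))
  simp only [E.dist_comm _ y] at hy
  have hgy : Tendsto (fun n => g (p n)) atTop (𝓝 y) :=
    E.tendsto_of_tendsto_dist tendsto_const_nhds hy
  obtain ⟨K, hK, hKy⟩ := exists_compact_mem_nhds y
  obtain ⟨V, hV, δ, hδ, hVK⟩ := E.exists_dist_lt_imp_mem hKy
  have hCp : Tendsto (fun n => C * ‖z₁ - p n‖) atTop (𝓝 0) := by
    simpa using (hps.const_sub z₁).norm.const_mul C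
  obtain ⟨n, hn1, hn2, hn3⟩ := ((hgy.eventually (eventually_mem_nhds_iff.2 hV)).and
    ((hCp.eventually (gt_mem_nhds hδ)).and (hps.eventually (ball_mem_nhds z₁ one_pos)))).exists
  obtain ⟨y', -, hy'⟩ := hK.exists_tendsto_ultrafilter 𝒰 (u := fun i => f i z₁) (by
    filter_upwards [hf' z₁, (hg _ (hBS (hpB n))).eventually hn1] with i h1 h2
    exact hVK _ h2 _ ((h1.1.dist_le E isOpen_ball (convex_ball z₁ 1) h1.2 hn3
      (mem_ball_self one_pos)).trans_lt ((ENNReal.ofReal_lt_ofReal_iff hδ).2 hn2)))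
  exact hz₁ ⟨y', hy'⟩

end Limits

/-! ### Extracting a subsequence from convergence along an ultrafilter -/

section Extraction

variable {M : Type*} [TopologicalSpace M] {ι : Type*}

/-- Local uniform convergence on `S` of maps between spaces without uniform structure on the target:
near every point the maps have values in any given neighbourhood of the value of the limit. -/
def ConvergesLocally (f : ι → ℂ → M) (l : Filter ι) (g : ℂ → M) (S : Set ℂ) : Prop :=
  ∀ z ∈ S, ∀ U ∈ 𝓝 (g z), ∃ ρ : ℝ, 0 < ρ ∧ ∀ᶠ i in l, ∀ w ∈ ball z ρ, f i w ∈ U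

theorem ConvergesLocally.eventually_mapsTo {f : ι → ℂ → M} {l : Filter ι} {g : ℂ → M} {S : Set ℂ}
    (h : ConvergesLocally f l g S) {K : Set ℂ} (hK : IsCompact K) (hKS : K ⊆ S) {U : Set M}
    (hU : IsOpen U) (hg : MapsTo g K U) : ∀ᶠ i in l, MapsTo (f i) K U := by
  refine hK.induction_on (p := fun K => ∀ᶠ i in l, MapsTo (f i) K U)
    (Eventually.of_forall fun _ => mapsTo_empty _ _) ?_ ?_ ?_
  · exact fun s t hst ht => ht.mono fun i hi => hi.mono_left hst
  · exact fun s t hs ht => (hs.and ht).mono fun i hi => hi.1.union hi.2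
  · intro z hz
    obtain ⟨ρ, hρ, hi⟩ := h z (hKS hz) U (hU.mem_nhds (hg hz))
    exact ⟨ball z ρ, mem_nhdsWithin_of_mem_nhds (ball_mem_nhds z hρ), hi⟩

variable [ReducedComplexSpace M]

/-- A continuous map from `ℂ` to a complex space meets only countably many coordinate domains, so
the topology of the space near its image is generated by countably many open sets. -/
theorem exists_countable_basis_along {g : ℂ → M} (hg : Continuous g) :
    ∃ 𝓑 : Set (Set M), 𝓑.Countable ∧
      ∀ z, ∀ U ∈ 𝓝 (g z), ∃ B ∈ 𝓑, B ∈ 𝓝 (g z) ∧ B ⊆ U := by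
  have hsc : ∀ φ : AnalyticChart M, SecondCountableTopology φ.source := fun φ =>
    φ.isEmbedding.secondCountableTopology
  obtain ⟨s, hs, hcov⟩ := TopologicalSpace.countable_cover_nhds
    (f := fun z => g ⁻¹' (chartAt (g z)).source) fun z =>
      hg.continuousAt.preimage_mem_nhds
        ((chartAt (g z)).isOpen_source.mem_nhds (mem_chartAt_source (g z)))
  refine ⟨⋃ z ∈ s, (fun b : Set (chartAt (g z)).source => Subtype.val '' b) ''
    TopologicalSpace.countableBasis (chartAt (g z)).source,
    hs.biUnion fun z _ => (TopologicalSpace.countable_countableBasis _).image _, ?_⟩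
  intro w U hU
  have hw : w ∈ ⋃ z ∈ s, g ⁻¹' (chartAt (g z)).source := hcov ▸ mem_univ w
  obtain ⟨z, hz, hwz⟩ := mem_iUnion₂.1 hw
  have hU' : Subtype.val ⁻¹' U ∈ 𝓝 (⟨g w, hwz⟩ : (chartAt (g z)).source) :=
    continuous_subtype_val.continuousAt.preimage_mem_nhds hU
  obtain ⟨b, hb, hwb, hbU⟩ :=
    (TopologicalSpace.isBasis_countableBasis (chartAt (g z)).source).mem_nhds_iff.1 hU'
  refine ⟨Subtype.val '' b, mem_iUnion₂.2 ⟨z, hz, b, hb, rfl⟩, ?_, image_subset_iff.2 hbU⟩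
  exact ((chartAt (g z)).isOpen_source.isOpenMap_subtype_val b
    (TopologicalSpace.isOpen_of_mem_countableBasis hb)).mem_nhds ⟨_, hwb, rfl⟩

theorem ConvergesLocally.exists_subseq {f : ℕ → ℂ → M} {l : Filter ℕ} [l.NeBot] (hl : l ≤ atTop)
    {g : ℂ → M} (hg : Continuous g) (h : ConvergesLocally f l g univ) :
    ∃ θ : ℕ → ℕ, StrictMono θ ∧ ConvergesLocally (fun n => f (θ n)) atTop g univ := by
  obtain ⟨𝓑, h𝓑, hbasis⟩ := exists_countable_basis_along hg
  -- the countably many conditions `MapsTo (f i) b B` that hold eventually imply local convergence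
  set 𝒞 : Set (Set ℂ × Set M) := {q ∈ TopologicalSpace.countableBasis ℂ ×ˢ 𝓑 |
    ∀ᶠ i in l, MapsTo (f i) q.1 q.2} with h𝒞
  have hcount : 𝒞.Countable :=
    ((TopologicalSpace.countable_countableBasis ℂ).prod h𝓑).mono (sep_subset _ _)
  have hkey : ∀ z, ∀ U ∈ 𝓝 (g z), ∃ q ∈ 𝒞, q.1 ∈ 𝓝 z ∧ q.2 ⊆ U := by
    intro z U hU
    obtain ⟨B, hB, hBz, hBU⟩ := hbasis z U hU
    obtain ⟨ρ, hρ, hev⟩ := h z (mem_univ z) B hBz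
    obtain ⟨b, hb, hzb, hbρ⟩ :=
      (TopologicalSpace.isBasis_countableBasis ℂ).mem_nhds_iff.1 (ball_mem_nhds z hρ)
    exact ⟨(b, B), ⟨⟨hb, hB⟩, hev.mono fun i hi w hw => hi w (hbρ hw)⟩,
      (TopologicalSpace.isOpen_of_mem_countableBasis hb).mem_nhds hzb, hBU⟩
  obtain ⟨q₀, hq₀, -⟩ := hkey 0 univ univ_mem
  obtain ⟨e, he⟩ := hcount.exists_eq_range ⟨q₀, hq₀⟩
  have hfreq : ∀ n, ∃ᶠ j in atTop, ∀ k ∈ Iic n, MapsTo (f j) (e k).1 (e k).2 := fun n =>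
    (((finite_Iic n).eventually_all (l := l)).2 fun k _ =>
      (he ▸ mem_range_self k : e k ∈ 𝒞).2).frequently.filter_mono hl
  obtain ⟨θ, hθ, hP⟩ := extraction_forall_of_frequently hfreq
  refine ⟨θ, hθ, fun z _ U hU => ?_⟩
  obtain ⟨q, hq, hqz, hqU⟩ := hkey z U hU
  rw [he] at hq
  obtain ⟨k, rfl⟩ := hq
  obtain ⟨ρ, hρ, hb⟩ := Metric.mem_nhds_iff.1 hqz
  refine ⟨ρ, hρ, ?_⟩
  filter_upwards [eventually_ge_atTop k] with n hn w hw
  exact hqU (hP n k hn (hb hw))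

theorem LengthFunction.LocallyBoundedSpeed.convergesLocally [T2Space M] {E : LengthFunction M}
    {l : Filter ι} {f : ι → ℂ → M} {g : ℂ → M} {S : Set ℂ} (hf : E.LocallyBoundedSpeed f l S)
    (hg : ∀ z ∈ S, Tendsto (fun i => f i z) l (𝓝 (g z))) : ConvergesLocally f l g S := by
  intro z hz U hU
  obtain ⟨R, C, hR, hRC⟩ := hf z hz
  exact E.eventually_forall_ball_mem hR hRC (hg z hz) hU

end Extraction

/-! ### Escape to infinity -/

section Escape

variable {M : Type*} [TopologicalSpace M]

/-- In a paracompact, locally compact space, a set that is not relatively compact contains a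
sequence that leaves every compact set: it meets infinitely many members of a locally finite cover
by relatively compact sets. -/
theorem exists_seq_eventually_notMem [T2Space M] [ParacompactSpace M] [LocallyCompactSpace M]
    {A : Set M} (hA : ∀ K, IsCompact K → ¬ A ⊆ K) :
    ∃ a : ℕ → M, (∀ n, a n ∈ A) ∧ ∀ L, IsCompact L → ∀ᶠ n in atTop, a n ∉ L := by
  choose K hK hKx using fun x : M => exists_compact_mem_nhds x
  obtain ⟨v, -, hcov, hfin, hsub⟩ := precise_refinement (fun x => interior (K x))
    (fun x => isOpen_interior)
    (eq_univ_of_forall fun x => mem_iUnion.2 ⟨x, mem_interior_iff_mem_nhds.2 (hKx x)⟩)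
  set I := {i | (v i ∩ A).Nonempty} with hI
  have hinf : I.Infinite := by
    intro hIf
    refine hA (⋃ i ∈ I, K i) (hIf.isCompact_biUnion fun i _ => hK i) fun y hy => ?_
    obtain ⟨i, hi⟩ := mem_iUnion.1 (hcov ▸ mem_univ y : y ∈ ⋃ i, v i)
    exact mem_iUnion₂.2 ⟨i, ⟨y, hi, hy⟩, interior_subset (hsub i hi)⟩
  choose a ha using fun n => (hinf.natEmbedding I n).2
  refine ⟨a, fun n => (ha n).2, fun L hL => ?_⟩
  rw [← Nat.cofinite_eq_atTop]
  have h1 : {n | ((hinf.natEmbedding I n : I) : M) ∈ {i | (v i ∩ L).Nonempty}}.Finite :=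
    (hfin.finite_nonempty_inter_compact hL).preimage
      (Subtype.val_injective.comp (hinf.natEmbedding I).injective).injOn
  refine (h1.subset fun n hn => ⟨a n, (ha n).1, ?_⟩).eventually_cofinite_notMem.mono
    fun n hn h => hn h
  exact hn

variable [ReducedComplexSpace M]

theorem LengthFunction.exists_compact_dist_lt [T2Space M] (E : LengthFunction M) {L : Set M}
    (hL : IsCompact L) : ∃ K : Set M, IsCompact K ∧ ∃ δ : ℝ, 0 < δ ∧
      ∀ y ∈ L, ∀ z, E.dist y z < ENNReal.ofReal δ → z ∈ K := by
  have : LocallyCompactSpace M := locallyCompactSpace_of_reducedComplexSpace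
  refine hL.induction_on (p := fun L => ∃ K : Set M, IsCompact K ∧ ∃ δ : ℝ, 0 < δ ∧
      ∀ y ∈ L, ∀ z, E.dist y z < ENNReal.ofReal δ → z ∈ K) ⟨∅, isCompact_empty, 1, one_pos, by simp⟩
    ?_ ?_ ?_
  · rintro s t hst ⟨K, hK, δ, hδ, h⟩
    exact ⟨K, hK, δ, hδ, fun y hy => h y (hst hy)⟩
  · rintro s t ⟨K, hK, δ, hδ, h⟩ ⟨K', hK', δ', hδ', h'⟩
    refine ⟨K ∪ K', hK.union hK', min δ δ', lt_min hδ hδ', ?_⟩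
    rintro y (hy | hy) z hz
    · exact Or.inl (h y hy z (hz.trans_le (ENNReal.ofReal_le_ofReal (min_le_left _ _))))
    · exact Or.inr (h' y hy z (hz.trans_le (ENNReal.ofReal_le_ofReal (min_le_right _ _))))
  · intro x _
    obtain ⟨K, hK, hKx⟩ := exists_compact_mem_nhds x
    obtain ⟨V, hV, δ, hδ, h⟩ := E.exists_dist_lt_imp_mem hKx
    exact ⟨V, mem_nhdsWithin_of_mem_nhds hV, K, hK, δ, hδ, h⟩

end Escape

/-! ### The space of holomorphic maps -/

section HolSpace

variable {M : Type*} [TopologicalSpace M] {Ω : Set ℂ}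

theorem AnalyticChart.read_eventuallyEq (φ : AnalyticChart M) (hΩ : IsOpen Ω) {f : Ω → M}
    {g : ℂ → M} (h : ∀ z : Ω, f z = g z) {z : ℂ} (hz : z ∈ Ω) :
    φ.read f =ᶠ[𝓝 z] fun w => φ.toFun (g w) := by
  filter_upwards [hΩ.mem_nhds hz] with w hw
  simp only [AnalyticChart.read, dif_pos hw, h]

variable [ReducedComplexSpace M]

open Classical in
/-- A holomorphic map on `Ω` as a map on `ℂ`, with an arbitrary constant value off `Ω`. -/
noncomputable def Hol.extend [Nonempty M] (f : Hol Ω M) (z : ℂ) : M :=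
  if hz : z ∈ Ω then f.1 ⟨z, hz⟩ else Classical.arbitrary M

theorem Hol.extend_apply [Nonempty M] (f : Hol Ω M) {z : ℂ} (hz : z ∈ Ω) :
    f.extend z = f.1 ⟨z, hz⟩ :=
  dif_pos hz

theorem Hol.holOn_extend [Nonempty M] (f : Hol Ω M) (hΩ : IsOpen Ω) : HolOn f.extend Ω := by
  refine ⟨?_, fun φ hφ z hz hs => ?_⟩
  · rw [continuousOn_iff_continuous_domRestrict]
    convert f.1.continuous using 1
    ext z
    exact f.extend_apply z.2
  · rw [f.extend_apply hz] at hs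
    exact ((φ.read_eventuallyEq hΩ (fun w => (f.extend_apply w.2).symm) hz).differentiableAt_iff).1
      (f.2 φ hφ ⟨z, hz⟩ hs)

/-- The element of `Hol(Ω, M)` defined by a map on `ℂ` that is holomorphic on `Ω`. -/
def HolOn.toHol {g : ℂ → M} (hg : HolOn g Ω) (hΩ : IsOpen Ω) : Hol Ω M :=
  ⟨⟨Ω.domRestrict g, continuousOn_iff_continuous_domRestrict.1 hg.1⟩, fun φ hφ z hs =>
    (φ.read_eventuallyEq hΩ (fun _ => rfl) z.2).differentiableAt_iff.2 (hg.2 φ hφ z z.2 hs)⟩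

theorem HolOn.toHol_apply {g : ℂ → M} (hg : HolOn g Ω) (hΩ : IsOpen Ω) (z : Ω) :
    (hg.toHol hΩ).1 z = g z :=
  rfl

/-- Bounded speed and pointwise relative compactness imply normality. -/
theorem isNormalFamily_of_speed_le [T2Space M] [Nonempty M] (E : LengthFunction M) (hΩ : IsOpen Ω)
    {F : Set (Hol Ω M)}
    (hspeed : ∀ z ∈ Ω, ∃ R C : ℝ, 0 < R ∧ ball z R ⊆ Ω ∧
      ∀ f ∈ F, ∀ w ∈ ball z R, E.speed f.extend w ≤ C)
    (hpt : ∀ z ∈ Ω, ∃ K : Set M, IsCompact K ∧ ∀ f ∈ F, f.extend z ∈ K) :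
    IsNormalFamily F := by
  choose! R C hR hRΩ hC using hspeed
  choose! K hK hFK using hpt
  -- the bounds pass to limits, so they define a compact set that contains `F`
  set F' : Set (Hol Ω M) := {f | ∀ z ∈ Ω, f.extend z ∈ K z ∧
    ∀ w ∈ ball z (R z), E.speed f.extend w ≤ C z} with hF'
  have hFF' : F ⊆ F' := fun f hf z hz => ⟨hFK z hz f hf, hC z hz f hf⟩
  have hcomp : IsCompact F' := by
    rw [isCompact_iff_ultrafilter_le_nhds']
    intro 𝒰 h𝒰
    have h𝒰' : ∀ᶠ f in (𝒰 : Filter (Hol Ω M)), f ∈ F' := h𝒰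
    choose! g _ hg using fun z (hz : z ∈ Ω) => (hK z hz).exists_tendsto_ultrafilter 𝒰
      (u := fun f : Hol Ω M => f.extend z) (h𝒰'.mono fun f hf => (hf z hz).1)
    have hlb : E.LocallyBoundedSpeed (fun f : Hol Ω M => f.extend) 𝒰 Ω := fun z hz =>
      ⟨R z, C z, hR z hz, h𝒰'.mono fun f hf =>
        ⟨(f.holOn_extend hΩ).mono (hRΩ z hz), (hf z hz).2⟩⟩
    have hgh : HolOn g Ω := hlb.holOn hΩ hg
    have hG : ∀ z ∈ Ω, Tendsto (fun f : Hol Ω M => f.extend z) 𝒰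
        (𝓝 ((hgh.toHol hΩ).extend z)) := fun z hz => by
      rw [Hol.extend_apply _ hz]
      exact hg z hz
    set G := hgh.toHol hΩ
    refine ⟨G, fun z hz => ⟨?_, fun w hw => ?_⟩, ?_⟩
    · exact (hK z hz).isClosed.mem_of_tendsto (hG z hz) (h𝒰'.mono fun f hf => (hf z hz).1)
    · exact le_of_tendsto (hlb.tendsto_speed hΩ hG (hRΩ z hz hw))
        (h𝒰'.mono fun f hf => (hf z hz).2 w hw)
    · have h1 : Tendsto (fun f : Hol Ω M => f.1) 𝒰 (𝓝 G.1) := by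
        rw [ContinuousMap.tendsto_nhds_compactOpen]
        intro K' hK' U hU hmaps
        have h2 := (hlb.convergesLocally hG).eventually_mapsTo
          (hK'.image continuous_subtype_val) (by rintro _ ⟨z, -, rfl⟩; exact z.2) hU (by
            rintro _ ⟨z, hz, rfl⟩
            rw [Hol.extend_apply _ z.2]
            exact hmaps hz)
        filter_upwards [h2] with f hf z hz
        have h3 := hf (mem_image_of_mem _ hz)
        rwa [Hol.extend_apply _ z.2] at h3
      exact tendsto_subtype_rng.2 h1
  exact hcomp.of_isClosed_subset isClosed_closure (closure_minimal hFF' hcomp.isClosed)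

end HolSpace

/-! ### Rescaling -/

section Rescaling

variable {M : Type*} [TopologicalSpace M] [ReducedComplexSpace M] {Ω : Set ℂ}

theorem LengthFunction.speed_eq_zero_of_const (E : LengthFunction M) {G : ℂ → M}
    (h : ∀ a b, G a = G b) (z : ℂ) : E.speed G z = 0 := by
  have h1 : (fun w => (chartAt (G z)).toFun (G w)) = fun _ => (chartAt (G z)).toFun (G z) :=
    funext fun w => by rw [h w z]
  rw [LengthFunction.speed, h1, deriv_const]
  exact (E.eq_zero_iff _ (chartAt_mem_atlas _) _ (mem_chartAt_source _) _
    (Submodule.zero_mem _)).2 rfl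

theorem rescale_eq_extend [Nonempty M] (f : Hol Ω M) (p : ℂ) (ρ : ℝ) (ξ : rescaleDomain Ω p ρ) :
    rescale f p ρ ξ = f.extend (p + (ρ : ℂ) * (ξ : ℂ)) :=
  (f.extend_apply ξ.2).symm

/-- Where the speed is bounded, the rescaled maps stay close to their values at the centre, so they
diverge if these values do. -/
theorem compactlyDivergent_rescale_of_speed_le [T2Space M] [Nonempty M] (E : LengthFunction M)
    (hΩ : IsOpen Ω) {f : ℕ → Hol Ω M} {z : ℂ} {R C : ℝ} (hR : 0 < R) (hRΩ : ball z R ⊆ Ω)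
    (hC : ∀ j, ∀ w ∈ ball z R, E.speed (f j).extend w ≤ C)
    (hdiv : ∀ L, IsCompact L → ∀ᶠ j in atTop, (f j).extend z ∉ L) {ρ : ℕ → ℝ}
    (hρ : Tendsto ρ atTop (𝓝 0)) :
    CompactlyDivergent (fun j => rescale (f j) z (ρ j)) := by
  intro K hK L hL
  obtain ⟨K', hK', δ, hδ, h⟩ := E.exists_compact_dist_lt hL
  obtain ⟨B, hB⟩ := hK.isBounded.exists_norm_le
  have h1 : Tendsto (fun j => |ρ j| * B) atTop (𝓝 0) := by
    simpa using hρ.abs.mul_const B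
  have h2 : Tendsto (fun j => |C| * (|ρ j| * B)) atTop (𝓝 0) := by
    simpa using h1.const_mul |C|
  filter_upwards [hdiv K' hK', h1.eventually (gt_mem_nhds hR), h2.eventually (gt_mem_nhds hδ)]
    with j hj1 hj2 hj3
  have hn : ∀ ξ ∈ K, ‖(ρ j : ℂ) * ξ‖ ≤ |ρ j| * B := fun ξ hξ => by
    rw [norm_mul, Complex.norm_real, Real.norm_eq_abs]
    exact mul_le_mul_of_nonneg_left (hB ξ hξ) (abs_nonneg _)
  have hmem : ∀ ξ ∈ K, z + (ρ j : ℂ) * ξ ∈ ball z R := fun ξ hξ => by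
    rw [mem_ball_iff_norm, add_sub_cancel_left]
    exact (hn ξ hξ).trans_lt hj2
  refine ⟨fun ξ hξ => hRΩ (hmem ξ hξ), fun ξ hξ hL' => hj1 ?_⟩
  rw [rescale_eq_extend] at hL'
  refine h _ hL' _ (((((f j).holOn_extend hΩ).mono hRΩ).dist_le E isOpen_ball (convex_ball z R)
    (hC j) (hmem _ hξ) (mem_ball_self hR)).trans_lt ((ENNReal.ofReal_lt_ofReal_iff hδ).2 ?_))
  rw [sub_add_cancel_left, norm_neg]
  exact ((mul_le_mul_of_nonneg_right (le_abs_self C) (norm_nonneg _)).trans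
    (mul_le_mul_of_nonneg_left (hn _ hξ) (abs_nonneg C))).trans_lt hj3

/-- Zalcman's rescaling at one scale: near a point of large speed, Hofer's lemma provides a point
`p` whose speed `1 / ρ` is large and, up to a factor `2`, maximal at a distance `n * ρ` from `p`. -/
theorem exists_rescaling [Nonempty M] (E : LengthFunction M) (hΩ : IsOpen Ω) {F : Set (Hol Ω M)}
    {z : ℂ} (hz : z ∈ Ω)
    (hF : ∀ R C : ℝ, 0 < R → ball z R ⊆ Ω → ∃ f ∈ F, ∃ w ∈ ball z R, C < E.speed f.extend w)
    {n ε : ℝ} (hn : 1 ≤ n) (hε : 0 < ε) :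
    ∃ f ∈ F, ∃ p ∈ Ω, ∃ ρ : ℝ, 0 < ρ ∧ ρ ≤ ε ∧ dist p z ≤ 3 * ε ∧
      ρ * E.speed f.extend p = 1 ∧
      ∀ ξ ∈ ball (0 : ℂ) n, p + ρ * ξ ∈ Ω ∧ ρ * E.speed f.extend (p + ρ * ξ) ≤ 2 := by
  obtain ⟨r, hr, hrΩ⟩ := nhds_basis_closedBall.mem_iff.1 (hΩ.mem_nhds hz)
  -- the point `p` of Hofer's lemma is within `3 * η` of `z`, and the disc of radius `η' ≤ η` around
  -- it has to stay in `closedBall z r`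
  set η := min ε (r / 4) with hη
  have hη0 : 0 < η := lt_min hε (by positivity)
  have hηε : η ≤ ε := min_le_left _ _
  have hηr : 4 * η ≤ r := by linarith [min_le_right ε (r / 4)]
  have hsubr : ball z η ⊆ closedBall z r :=
    ball_subset_closedBall.trans (closedBall_subset_closedBall (by linarith))
  obtain ⟨f, hf, w, hw, hwC⟩ := hF η (n / η) hη0 (hsubr.trans hrΩ)
  have hfh := f.holOn_extend hΩ
  have hcont : Continuous fun q : closedBall z r => E.speed f.extend q :=
    continuous_iff_continuousAt.2 fun q =>
      (hfh.continuousAt_speed E hΩ (hrΩ q.2)).comp continuous_subtype_val.continuousAt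
  have : CompleteSpace (closedBall z r) := isClosed_closedBall.completeSpace_coe
  obtain ⟨η', hη'0, ⟨p, hpr⟩, hη', hpw, hle, hmax⟩ := hofer (⟨w, hsubr hw⟩ : closedBall z r) η hη0
    hcont fun q => hfh.speed_nonneg E hΩ (hrΩ q.2)
  simp only [Subtype.dist_eq, Subtype.forall] at hpw hle hmax
  have hnp : n < η' * E.speed f.extend p := by
    rw [div_lt_iff₀' hη0] at hwC
    exact hwC.trans_le hle
  have hsp : 0 < E.speed f.extend p := pos_of_mul_pos_right (by linarith) hη'0.le
  set ρ := (E.speed f.extend p)⁻¹ with hρ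
  have hρ0 : 0 < ρ := inv_pos.2 hsp
  have hnρ : n * ρ < η' := by
    rwa [hρ, ← div_eq_mul_inv, div_lt_iff₀ hsp]
  have hpz : dist p z ≤ 3 * η := by
    have := dist_triangle p w z
    rw [mem_ball] at hw
    linarith
  refine ⟨f, hf, p, hrΩ hpr, ρ, hρ0, ?_, hpz.trans (by linarith), inv_mul_cancel₀ hsp.ne', ?_⟩
  · nlinarith
  · intro ξ hξ
    have h1 : dist p (p + ρ * ξ) ≤ η' := by
      rw [dist_self_add_right, norm_mul, Complex.norm_real, Real.norm_of_nonneg hρ0.le]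
      rw [mem_ball_zero_iff] at hξ
      nlinarith
    have h2 : p + ρ * ξ ∈ closedBall z r := by
      have := dist_triangle_left (p + ρ * ξ) z p
      rw [mem_closedBall]
      linarith
    refine ⟨hrΩ h2, ?_⟩
    calc ρ * E.speed f.extend (p + ρ * ξ) ≤ ρ * (2 * E.speed f.extend p) :=
          mul_le_mul_of_nonneg_left (hmax _ h2 h1) hρ0.le
      _ = 2 := by
          rw [mul_left_comm, inv_mul_cancel₀ hsp.ne', mul_one]

end Rescaling

/-! ### Convergent or divergent rescalings -/

section Dichotomy

variable {M : Type*} [TopologicalSpace M] [T2Space M] [ReducedComplexSpace M]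

/-- If maps of bounded speed on larger and larger discs do not diverge on a compact set, then they
converge at a point along an ultrafilter. -/
theorem exists_ultrafilter_tendsto (E : LengthFunction M) {g : ℕ → ℂ → M} {C : ℝ}
    (hg : ∀ R : ℝ, ∀ᶠ j in atTop, HolOn (g j) (ball 0 R) ∧ ∀ w ∈ ball 0 R, E.speed (g j) w ≤ C)
    {K : Set ℂ} (hK : IsCompact K) {L : Set M} (hL : IsCompact L)
    (hfreq : ∃ᶠ j in atTop, ∃ ξ ∈ K, g j ξ ∈ L) :
    ∃ 𝒰 : Ultrafilter ℕ, (𝒰 : Filter ℕ) ≤ atTop ∧ ∃ ξ x, Tendsto (fun j => g j ξ) 𝒰 (𝓝 x) := by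
  set S := {j | ∃ ξ ∈ K, g j ξ ∈ L} with hS
  have : (atTop ⊓ 𝓟 S).NeBot := frequently_mem_iff_neBot.1 hfreq
  have hle := Ultrafilter.of_le (atTop ⊓ 𝓟 S)
  set 𝒰 := Ultrafilter.of (atTop ⊓ 𝓟 S)
  have htop : (𝒰 : Filter ℕ) ≤ atTop := hle.trans inf_le_left
  have hSU : ∀ᶠ j in (𝒰 : Filter ℕ), j ∈ S := le_principal_iff.1 (hle.trans inf_le_right)
  choose! ξ hξK hξL using fun j (hj : j ∈ S) => hj
  obtain ⟨ξ₀, -, hξ₀⟩ := hK.exists_tendsto_ultrafilter 𝒰 (u := ξ) (hSU.mono hξK)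
  obtain ⟨x, -, hx⟩ := hL.exists_tendsto_ultrafilter 𝒰 (u := fun j => g j (ξ j)) (hSU.mono hξL)
  refine ⟨𝒰, htop, ξ₀, x, E.tendsto_of_tendsto_dist hx ?_⟩
  have h1 : Tendsto (fun j => ENNReal.ofReal (C * ‖ξ₀ - ξ j‖)) 𝒰 (𝓝 0) := by
    have h2 : Tendsto (fun j => C * ‖ξ₀ - ξ j‖) 𝒰 (𝓝 0) := by
      simpa using (hξ₀.const_sub ξ₀).norm.const_mul C
    simpa [Function.comp_def] using (ENNReal.continuous_ofReal.tendsto _).comp h2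
  refine tendsto_of_tendsto_of_tendsto_of_le_of_le' tendsto_const_nhds h1
    (Eventually.of_forall fun _ => zero_le) ?_
  have hmem : ξ₀ ∈ ball (0 : ℂ) (‖ξ₀‖ + 1) := by simp
  filter_upwards [(hg (‖ξ₀‖ + 1)).filter_mono htop,
    hξ₀.eventually (isOpen_ball.mem_nhds hmem)] with j h3 h4
  exact h3.1.dist_le E isOpen_ball (convex_ball _ _) h3.2 h4 hmem

/-- Maps of bounded speed on larger and larger discs that do not diverge on a compact set have a
subsequence that converges to an entire curve; the speed passes to the limit. -/
theorem exists_entire_limit (E : LengthFunction M) (hE : E.IsComplete) {g : ℕ → ℂ → M} {C : ℝ}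
    (hg : ∀ R : ℝ, ∀ᶠ j in atTop, HolOn (g j) (ball 0 R) ∧ ∀ w ∈ ball 0 R, E.speed (g j) w ≤ C)
    (hg0 : ∀ j, E.speed (g j) 0 = 1)
    {K : Set ℂ} (hK : IsCompact K) {L : Set M} (hL : IsCompact L)
    (hfreq : ∃ᶠ j in atTop, ∃ ξ ∈ K, g j ξ ∈ L) :
    ∃ θ : ℕ → ℕ, StrictMono θ ∧ ∃ G : ℂ → M, HolOn G univ ∧ (∀ z, E.speed G z ≤ C) ∧
      E.speed G 0 = 1 ∧ ConvergesLocally (fun n => g (θ n)) atTop G univ := by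
  obtain ⟨𝒰, htop, ξ, x, hx⟩ := exists_ultrafilter_tendsto E hg hK hL hfreq
  choose G hG using fun z => hE.exists_tendsto 𝒰 (fun R => (hg R).filter_mono htop) hx z
  have hlb : E.LocallyBoundedSpeed g 𝒰 univ := fun z _ => by
    have hsub : ball z 1 ⊆ ball 0 (‖z‖ + 1) :=
      ball_subset_ball' (by rw [dist_zero_right, add_comm])
    exact ⟨1, C, one_pos, ((hg (‖z‖ + 1)).filter_mono htop).mono fun j hj =>
      ⟨hj.1.mono hsub, fun w hw => hj.2 w (hsub hw)⟩⟩
  have hG' : ∀ z ∈ univ, Tendsto (fun j => g j z) 𝒰 (𝓝 (G z)) := fun z _ => hG z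
  have hhol : HolOn G univ := hlb.holOn isOpen_univ hG'
  obtain ⟨θ, hθ, hconv⟩ := (hlb.convergesLocally hG').exists_subseq htop
    (continuousOn_univ.1 hhol.1)
  refine ⟨θ, hθ, G, hhol, fun z => ?_, ?_, hconv⟩
  · exact le_of_tendsto (hlb.tendsto_speed isOpen_univ hG' (mem_univ z))
      (((hg (‖z‖ + 1)).filter_mono htop).mono fun j hj => hj.2 z (by simp))
  · refine tendsto_nhds_unique (hlb.tendsto_speed isOpen_univ hG' (mem_univ 0)) ?_
    simp only [hg0]
    exact tendsto_const_nhds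

end Dichotomy

/-! ### The normality criterion -/

section Normality

variable {M : Type*} [TopologicalSpace M] [T2Space M] [ReducedComplexSpace M] {Ω : Set ℂ}

/-- Unbounded speed near a point produces, by rescaling, a divergent sequence or a Brody curve. -/
theorem exists_rescaled_limit [Nonempty M] (E : LengthFunction M) (hE : E.IsComplete)
    (hΩ : IsOpen Ω) {F : Set (Hol Ω M)} {z : ℂ} (hz : z ∈ Ω)
    (hF : ∀ R C : ℝ, 0 < R → ball z R ⊆ Ω → ∃ f ∈ F, ∃ w ∈ ball z R, C < E.speed f.extend w) :
    ∃ (p : ℕ → ℂ) (f : ℕ → Hol Ω M) (ρ : ℕ → ℝ),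
      (∀ j, p j ∈ Ω) ∧ Tendsto p atTop (𝓝 z) ∧ (∀ j, f j ∈ F) ∧
      (∀ j, 0 < ρ j) ∧ Tendsto ρ atTop (𝓝 0) ∧
      (CompactlyDivergent (fun j => rescale (f j) (p j) (ρ j)) ∨
        ∃ g : Hol univ M, IsBrodyCurve E g ∧ (∃ a b, g.1 a ≠ g.1 b) ∧
          ConvergesOnCompacts (fun j => rescale (f j) (p j) (ρ j)) g) := by
  choose f hf p hp ρ hρ0 hρε hpz hsp0 hsp using fun j : ℕ =>
    exists_rescaling E hΩ hz hF (n := (j : ℝ) + 1) (ε := 1 / ((j : ℝ) + 1)) (by simp) (by positivity)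
  have hρ : Tendsto ρ atTop (𝓝 0) :=
    squeeze_zero (fun j => (hρ0 j).le) hρε tendsto_one_div_add_atTop_nhds_zero_nat
  have hpt : Tendsto p atTop (𝓝 z) := tendsto_iff_dist_tendsto_zero.2
    (squeeze_zero (fun j => dist_nonneg) hpz
      (by simpa using (tendsto_one_div_add_atTop_nhds_zero_nat (𝕜 := ℝ)).const_mul 3))
  set g : ℕ → ℂ → M := fun j ξ => (f j).extend (p j + (ρ j : ℂ) * ξ) with hgdef
  have hnorm : ∀ j, ‖(ρ j : ℂ)‖ = ρ j := fun j => by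
    rw [Complex.norm_real, Real.norm_of_nonneg (hρ0 j).le]
  have hdom : ∀ R : ℝ, ∀ᶠ j : ℕ in atTop, ∀ w ∈ ball (0 : ℂ) R, w ∈ ball (0 : ℂ) ((j : ℝ) + 1) :=
    fun R => by
      filter_upwards [(tendsto_natCast_atTop_atTop (R := ℝ)).eventually_ge_atTop R] with j hj w hw
      exact ball_subset_ball (by linarith) hw
  have hg : ∀ R : ℝ, ∀ᶠ j in atTop,
      HolOn (g j) (ball 0 R) ∧ ∀ w ∈ ball 0 R, E.speed (g j) w ≤ 2 := fun R => by
    filter_upwards [hdom R] with j hj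
    refine ⟨(((f j).holOn_extend hΩ).comp_affine (p j) (ρ j)).mono fun w hw =>
      (hsp j w (hj w hw)).1, fun w hw => ?_⟩
    rw [((f j).holOn_extend hΩ).speed_comp_affine E hΩ _ _ (hsp j w (hj w hw)).1, hnorm]
    exact (hsp j w (hj w hw)).2
  have hg0 : ∀ j, E.speed (g j) 0 = 1 := fun j => by
    rw [((f j).holOn_extend hΩ).speed_comp_affine E hΩ _ _ (by simpa using hp j), hnorm]
    simpa using hsp0 j
  have hKD : ∀ K : Set ℂ, IsCompact K → ∀ᶠ j in atTop, K ⊆ rescaleDomain Ω (p j) (ρ j) := by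
    intro K hK
    obtain ⟨R, hR⟩ := hK.isBounded.subset_ball 0
    exact (hdom R).mono fun j hj ξ hξ => (hsp j ξ (hj ξ (hR hξ))).1
  by_cases hdiv : CompactlyDivergent (fun j => rescale (f j) (p j) (ρ j))
  · exact ⟨p, f, ρ, hp, hpt, hf, hρ0, hρ, Or.inl hdiv⟩
  · simp only [CompactlyDivergent, not_forall] at hdiv
    obtain ⟨K, hK, L, hL, hnot⟩ := hdiv
    have hfreq : ∃ᶠ j in atTop, ∃ ξ ∈ K, g j ξ ∈ L := by
      refine ((not_eventually.1 hnot).and_eventually (hKD K hK)).mono fun j hj => ?_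
      by_contra! hcon
      refine hj.1 ⟨hj.2, fun ξ hξ => ?_⟩
      rw [rescale_eq_extend]
      exact hcon ξ hξ
    obtain ⟨θ, hθ, G, hG, hGs, hG0, hconv⟩ := exists_entire_limit E hE hg hg0 hK hL hfreq
    have hθt := hθ.tendsto_atTop
    refine ⟨p ∘ θ, f ∘ θ, ρ ∘ θ, fun j => hp _, hpt.comp hθt, fun j => hf _, fun j => hρ0 _,
      hρ.comp hθt, Or.inr ⟨hG.toHol isOpen_univ, ⟨2, fun φ hφ w hw => ?_⟩, ?_, ?_⟩⟩
    · rw [(φ.read_eventuallyEq isOpen_univ (fun u => hG.toHol_apply isOpen_univ u)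
        (mem_univ (w : ℂ))).deriv_eq]
      exact (hG.speed_eq E isOpen_univ (mem_univ (w : ℂ)) hφ hw).symm.trans_le (hGs w)
    · by_contra! hcon
      have h0 := E.speed_eq_zero_of_const (G := G)
        (fun a b => hcon ⟨a, mem_univ a⟩ ⟨b, mem_univ b⟩) 0
      rw [hG0] at h0
      exact one_ne_zero h0
    · intro K' hK' U hU hmaps
      filter_upwards [hconv.eventually_mapsTo hK' (subset_univ _) hU
        (fun ξ hξ => hmaps ⟨ξ, mem_univ ξ⟩ hξ), hθt.eventually (hKD K' hK')] with j h1 h2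
      refine ⟨h2, fun ξ hξ => ?_⟩
      rw [rescale_eq_extend]
      exact h1 hξ

/-- Along any filter, rescalings of a convergent family at an interior point converge to a
constant. -/
theorem tendsto_rescale_of_tendsto [Nonempty M] (hΩ : IsOpen Ω) {l : Filter ℕ} {f : ℕ → Hol Ω M}
    {G : Hol Ω M} (hf : Tendsto f l (𝓝 G)) {p : ℕ → ℂ} {p₀ : ℂ} (hp₀ : p₀ ∈ Ω)
    (hp : Tendsto p l (𝓝 p₀)) {ρ : ℕ → ℝ} (hρ : Tendsto ρ l (𝓝 0)) (ξ : ℂ) :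
    Tendsto (fun j => (f j).extend (p j + (ρ j : ℂ) * ξ)) l (𝓝 (G.extend p₀)) := by
  classical
  have : LocallyCompactSpace Ω := hΩ.locallyCompactSpace
  have hq : Tendsto (fun j => p j + (ρ j : ℂ) * ξ) l (𝓝 p₀) := by
    have h1 : Tendsto (fun j => (ρ j : ℂ)) l (𝓝 ((0 : ℝ) : ℂ)) :=
      (Complex.continuous_ofReal.tendsto 0).comp hρ
    simpa using hp.add (h1.mul_const ξ)
  have hev : ∀ᶠ j in l, p j + (ρ j : ℂ) * ξ ∈ Ω := hq.eventually (hΩ.mem_nhds hp₀)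
  set q : ℕ → Ω := fun j =>
    if h : p j + (ρ j : ℂ) * ξ ∈ Ω then ⟨p j + (ρ j : ℂ) * ξ, h⟩ else ⟨p₀, hp₀⟩ with hqdef
  have hqe : ∀ᶠ j in l, (q j : ℂ) = p j + (ρ j : ℂ) * ξ := hev.mono fun j hj => by
    simp only [hqdef, dif_pos hj]
  have hqt : Tendsto q l (𝓝 ⟨p₀, hp₀⟩) :=
    tendsto_subtype_rng.2 (hq.congr' (hqe.mono fun j hj => hj.symm))
  have hft : Tendsto (fun j => (f j).1) l (𝓝 G.1) := tendsto_subtype_rng.1 hf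
  have h2 : Tendsto (fun j => (f j).1 (q j)) l (𝓝 (G.1 ⟨p₀, hp₀⟩)) :=
    (ContinuousEval.continuous_eval.tendsto (G.1, (⟨p₀, hp₀⟩ : Ω))).comp (hft.prodMk_nhds hqt)
  rw [G.extend_apply hp₀]
  refine h2.congr' (hqe.mono fun j hj => ?_)
  beta_reduce
  rw [← hj, Hol.extend_apply _ (q j).2]

/-- A normal family has no rescaling of either kind. -/
theorem IsNormalFamily.not_rescaling {E : LengthFunction M} (hΩ : IsOpen Ω) {F : Set (Hol Ω M)}
    (hF : IsNormalFamily F) {p : ℕ → ℂ} {p₀ : ℂ} {f : ℕ → Hol Ω M} {ρ : ℕ → ℝ} (hp₀ : p₀ ∈ Ω)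
    (hp : Tendsto p atTop (𝓝 p₀)) (hf : ∀ j, f j ∈ F) (hρ : Tendsto ρ atTop (𝓝 0)) :
    ¬ (CompactlyDivergent (fun j => rescale (f j) (p j) (ρ j)) ∨
      ∃ g : Hol univ M, IsBrodyCurve E g ∧ (∃ a b, g.1 a ≠ g.1 b) ∧
        ConvergesOnCompacts (fun j => rescale (f j) (p j) (ρ j)) g) := by
  have : LocallyCompactSpace M := locallyCompactSpace_of_reducedComplexSpace
  have : Nonempty M := ⟨(f 0).1 ⟨p₀, hp₀⟩⟩
  have htop : (hyperfilter ℕ : Filter ℕ) ≤ atTop := Nat.hyperfilter_le_atTop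
  obtain ⟨G, -, hG⟩ := hF.exists_tendsto_ultrafilter (hyperfilter ℕ) (u := f)
    (Eventually.of_forall fun j => subset_closure (hf j))
  have hlim := tendsto_rescale_of_tendsto hΩ hG hp₀ (hp.mono_left htop) (hρ.mono_left htop)
  rintro (hdiv | ⟨g, -, ⟨a, b, hab⟩, hconv⟩)
  · obtain ⟨L, hL, hLx⟩ := exists_compact_mem_nhds (G.extend p₀)
    obtain ⟨j, hj1, hj2⟩ := (((hdiv {0} isCompact_singleton L hL).filter_mono htop).and
      ((hlim 0).eventually hLx)).exists
    have h0 : (0 : ℂ) ∈ rescaleDomain Ω (p j) (ρ j) := hj1.1 rfl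
    have h1 : rescale (f j) (p j) (ρ j) ⟨0, h0⟩ ∈ L := by
      rw [rescale_eq_extend]
      exact hj2
    exact hj1.2 ⟨0, h0⟩ rfl h1
  · have key : ∀ c : (univ : Set ℂ), g.1 c = G.extend p₀ := fun c => by
      refine tendsto_nhds_unique (f := fun j => (f j).extend (p j + (ρ j : ℂ) * (c : ℂ)))
        (l := (hyperfilter ℕ : Filter ℕ)) ?_ (hlim c)
      refine Tendsto.mono_left ?_ htop
      rw [_root_.tendsto_nhds]
      intro U hU hc
      filter_upwards [hconv {(c : ℂ)} isCompact_singleton U hU fun ξ hξ => by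
        rwa [show ξ = c from Subtype.ext hξ]] with j hj
      have h1 := hj.2 ⟨c, hj.1 rfl⟩ rfl
      rwa [rescale_eq_extend] at h1
    exact hab ((key a).trans (key b).symm)

end Normality

theorem theorem1p5 {M : Type*} [TopologicalSpace M] [T2Space M] [ParacompactSpace M]
    [ReducedComplexSpace M] (E : LengthFunction M) (hE : E.IsHermitian) (hcomplete : E.IsComplete)
    (Ω : Set ℂ) (hΩ : IsOpen Ω) (hΩconn : IsConnected Ω) (F : Set (Hol Ω M)) :
    ¬ IsNormalFamily F ↔
      ∃ (p : ℕ → ℂ) (p₀ : ℂ) (f : ℕ → Hol Ω M) (ρ : ℕ → ℝ),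
        (∀ j, p j ∈ Ω) ∧ p₀ ∈ Ω ∧ Tendsto p atTop (𝓝 p₀) ∧
        (∀ j, f j ∈ F) ∧
        (∀ j, 0 < ρ j) ∧ Tendsto ρ atTop (𝓝 0) ∧
        (CompactlyDivergent (fun j => rescale (f j) (p j) (ρ j)) ∨
          ∃ g : Hol univ M, IsBrodyCurve E g ∧ (∃ a b, g.1 a ≠ g.1 b) ∧
            ConvergesOnCompacts (fun j => rescale (f j) (p j) (ρ j)) g) := by
  constructor
  · intro hF
    have hFne : F.Nonempty := by
      rw [nonempty_iff_ne_empty]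
      rintro rfl
      exact hF (by simp [IsNormalFamily])
    obtain ⟨f₀, -⟩ := hFne
    have : Nonempty M := hΩconn.nonempty.elim fun z hz => ⟨f₀.1 ⟨z, hz⟩⟩
    have : LocallyCompactSpace M := locallyCompactSpace_of_reducedComplexSpace
    by_cases hspeed : ∀ z ∈ Ω, ∃ R C : ℝ, 0 < R ∧ ball z R ⊆ Ω ∧
      ∀ f ∈ F, ∀ w ∈ ball z R, E.speed f.extend w ≤ C
    -- bounded speed: the values at some point escape to infinity
    · have hpt : ¬ ∀ z ∈ Ω, ∃ K : Set M, IsCompact K ∧ ∀ f ∈ F, f.extend z ∈ K :=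
        fun hpt => hF (isNormalFamily_of_speed_le E hΩ hspeed hpt)
      push Not at hpt
      obtain ⟨z, hz, hK⟩ := hpt
      obtain ⟨R, C, hR, hRΩ, hC⟩ := hspeed z hz
      obtain ⟨a, ha, hdiv⟩ := exists_seq_eventually_notMem (A := (fun f : Hol Ω M => f.extend z) '' F)
        fun K hKc hsub => by
          obtain ⟨f, hf, hfK⟩ := hK K hKc
          exact hfK (hsub (mem_image_of_mem _ hf))
      choose f hf hfa using ha
      refine ⟨fun _ => z, z, f, fun j => 1 / ((j : ℝ) + 1), fun _ => hz, hz, tendsto_const_nhds, hf,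
        fun j => by positivity, tendsto_one_div_add_atTop_nhds_zero_nat, Or.inl ?_⟩
      refine compactlyDivergent_rescale_of_speed_le E hΩ hR hRΩ (fun j => hC _ (hf j))
        (fun L hL => ?_) tendsto_one_div_add_atTop_nhds_zero_nat
      simpa only [hfa] using hdiv L hL
    -- unbounded speed near some point: Zalcman's rescaling
    · push Not at hspeed
      obtain ⟨z, hz, hunb⟩ := hspeed
      obtain ⟨p, f, ρ, hp, hpz, hf, hρ0, hρ, h⟩ := exists_rescaled_limit E hcomplete hΩ hz hunb
      exact ⟨p, z, f, ρ, hp, hz, hpz, hf, hρ0, hρ, h⟩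
  · rintro ⟨p, p₀, f, ρ, -, hp₀, hp, hf, -, hρ, h⟩ hF
    exact hF.not_rescaling hΩ hp₀ hp hf hρ h
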